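/- Let $n\ge 3$ be odd and let $U_v(\mathfrak g)$ be the quantized enveloping algebra of $\mathfrak g=\mathfrak{sl}_{n+1}$ over $\mathbb Q(v)$. It is generated by $E_i,F_i,K_i^{\pm1}$ ($1\le i\le n$) subject to $K_iK_j=K_jK_i$, $K_iK_i^{-1}=K_i^{-1}K_i=1$, $K_iE_jK_i^{-1}=v^{a_{ij}}E_j$, $K_iF_jK_i^{-1}=v^{-a_{ij}}F_j$, $E_iF_j-F_jE_i=\delta_{ij}\frac{K_i-K_i^{-1}}{v-v^{-1}}$, the relations $E_i^2E_j-(v+v^{-1})E_iE_jE_i+E_jE_i^2=0$ and $F_i^2F_j-(v+v^{-1})F_iF_jF_i+F_jF_i^2=0$ for $|i-j|=1$, and $E_iE_j=E_jE_i$, $F_iF_j=F_jF_i$ for $|i-j|\ge 2$, where $(a_{ij})$ is the Cartan matrix of type $A_n$. Let $T_i$ be Lusztig's algebra automorphism of $U_v(\mathfrak g)$ with - $T_i(E_i)=-K_i^{-1}F_i$, $T_i(F_i)=-E_iK_i$, $T_i(K_j)=K_jK_i^{-a_{ij}}$; - $T_i(E_j)=E_jE_i-v^{-1}E_iE_j$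 and $T_i(F_j)=F_iF_j-vF_jF_i$ if $|i-j|=1$; - $T_i(E_j)=E_j$ and $T_i(F_j)=F_j$ if $|i-j|\ge 2$. Let $(j_1,\dots,j_{2n})=(1,3,\dots,n,\,2,4,\dots,n-1,\,1,3,\dots,n,\,2,4,\dots,n-1)$, let $w=s_{j_1}s_{j_2}\cdots s_{j_{2n}}$ be the corresponding element of the Weyl group, put $E(\beta_k)=T_{j_1}T_{j_2}\cdots T_{j_{k-1}}(E_{j_k})$ for $1\le k\le 2n$, and let $U_v^+(w)$ be the subalgebra generated by $E(\beta_1),\dots,E(\beta_{2n})$. In this order, the elements $E(\beta_1),\dots,E(\beta_{2n})$ are denoted $$u_1,u_3,\dots,u_n,\;v_2,v_4,\dots,v_{n-1},\;w_1,w_3,\dots,w_n,\;x_2,x_4,\dots,x_{n-1}.$$ Thus, with $T=T_1T_3\cdots T_nT_2T_4\cdots T_{n-1}$, we have $u_i=T_1T_3\cdots T_{i-2}(E_i)$ and $w_i=T(u_i)$ for odd $i$, and $v_i=T_1T_3\cdots T_nT_2T_4\cdots T_{i-2}(E_i)$ and $x_i=T(v_i)$ for even $i$. Then the following relations hold in $U_v^+(w)$,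 where $i$ runs through the odd, respectively even, integers in the indicated range (an empty range gives no relation): \begin{align*} &v_{i+1}u_i=v\,u_iv_{i+1} && (i=1,3,\dots,n-2),\\ &v_{i-1}u_i=v\,u_iv_{i-1} && (i=3,5,\dots,n),\\ &w_{i+2}u_i=v\,u_iw_{i+2} && (i=1,3,\dots,n-2),\\ &w_{i-2}u_i=v\,u_iw_{i-2} && (i=3,5,\dots,n),\\ &w_1u_1=v^{-1}u_1w_1+v_2, &&\\ &w_iu_i=u_iw_i+(v-v^{-1})v_{i-1}v_{i+1} && (i=3,5,\dots,n-2),\\ &w_nu_n=v^{-1}u_nw_n+v_{n-1}, &&\\ &x_{i+3}u_i=v\,u_ix_{i+3} && (i=1,3,\dots,n-4),\\ &x_{i-3}u_i=v\,u_ix_{i-3} && (i=5,7,\dots,n),\\ &x_{i-1}u_i=u_ix_{i-1}+(v-v^{-1})v_{i+1}w_{i-2} && (i=3,5,\dots,n-2),\\ &x_{n-1}u_n=v^{-1}u_nx_{n-1}+w_{n-2}, &&\\ &x_2u_1=v^{-1}u_1x_2+w_3, &&\\ &x_{i+1}u_i=u_ix_{i+1}+(v-v^{-1})v_{i-1}w_{i+2}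 && (i=3,5,\dots,n-2),\\ &w_{i+1}v_i=v\,v_iw_{i+1} && (i=2,4,\dots,n-1),\\ &w_{i-1}v_i=v\,v_iw_{i-1} && (i=2,4,\dots,n-1),\\ &x_{i+2}v_i=v\,v_ix_{i+2} && (i=2,4,\dots,n-3),\\ &x_{i-2}v_i=v\,v_ix_{i-2} && (i=4,6,\dots,n-1),\\ &x_iv_i=v_ix_i+(v-v^{-1})w_{i-1}w_{i+1} && (i=2,4,\dots,n-1),\\ &x_{i+1}w_i=v\,w_ix_{i+1} && (i=1,3,\dots,n-2),\\ &x_{i-1}w_i=v\,w_ix_{i-1} && (i=3,5,\dots,n). \end{align*} Moreover, for all $1\le i<j\le 2n$ such that $E(\beta_j)E(\beta_i)$ is not one of the left-hand sides above, $E(\beta_j)E(\beta_i)=E(\beta_i)E(\beta_j)$. -/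

import Mathlib

namespace QuantumGroup

section Identities

variable {k A : Type*} [Field k] [Ring A] [Algebra k A] {q : k}

theorem serre_left (hq : q ≠ 0) {X Y D : A} {c : k} (h1 : X * Y = q⁻¹ • (Y * X) + c • D)
    (h2 : X * D = q • (D * X)) :
    X * X * Y - (q + q⁻¹) • (X * Y * X) + Y * X * X = 0 := by
  have e1 := congrArg (fun z => X * z) h1
  have e2 := congrArg (fun z => z * X) h1
  simp only [mul_add, add_mul, mul_smul_comm, smul_mul_assoc, ← mul_assoc] at e1 e2
  rw [h2] at e1
  linear_combination (norm := (match_scalars <;> field_simp <;> ring)) e1 - q • e2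

theorem serre_right (hq : q ≠ 0) {X Y D : A} {c : k} (h1 : X * Y = q⁻¹ • (Y * X) + c • D)
    (h2 : D * Y = q • (Y * D)) :
    Y * Y * X - (q + q⁻¹) • (Y * X * Y) + X * Y * Y = 0 := by
  have e1 := congrArg (fun z => Y * z) h1
  have e2 := congrArg (fun z => z * Y) h1
  simp only [mul_add, add_mul, mul_smul_comm, smul_mul_assoc, ← mul_assoc] at e1 e2
  rw [h2] at e2
  linear_combination (norm := (match_scalars <;> field_simp <;> ring)) e2 - q • e1

/-- The `q`-commutator `b a - q⁻¹ a b`. -/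
def qcomm (q : k) (b a : A) : A := b * a - q⁻¹ • (a * b)

theorem mul_qcomm (hq : q ≠ 0) {a b : A}
    (h : a * a * b - (q + q⁻¹) • (a * b * a) + b * a * a = 0) :
    a * qcomm q b a = q⁻¹ • (qcomm q b a * a) := by
  simp only [qcomm, mul_sub, sub_mul, mul_smul_comm, smul_mul_assoc, ← mul_assoc]
  linear_combination (norm := (match_scalars <;> field_simp <;> ring)) (-q⁻¹) • h

theorem mul_qcomm' (hq : q ≠ 0) {a b : A}
    (h : b * b * a - (q + q⁻¹) • (b * a * b) + a * b * b = 0) :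
    b * qcomm q b a = q • (qcomm q b a * b) := by
  simp only [qcomm, mul_sub, sub_mul, mul_smul_comm, smul_mul_assoc, ← mul_assoc]
  linear_combination (norm := (match_scalars <;> field_simp <;> ring)) h

theorem qcomm_qcomm (hq : q ≠ 0) (hq2 : q ^ 2 + 1 ≠ 0) {a b c : A} {t : k}
    (hbc : b * c = t • (c * b))
    (hb : a * a * b - (q + q⁻¹) • (a * b * a) + b * a * a = 0)
    (hc : a * a * c - (q + q⁻¹) • (a * c * a) + c * a * a = 0) :
    qcomm q b a * qcomm q c a = t • (qcomm q c a * qcomm q b a) := by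
  have yb := mul_qcomm hq hb
  have yc := mul_qcomm hq hc
  have key : (q ^ 2 + 1) •
      (qcomm q b a * qcomm q c a - t • (qcomm q c a * qcomm q b a)) = 0 := by
    have p1 : qcomm q b a * qcomm q c a = qcomm q b a * c * a - a * (qcomm q b a * c) := by
      conv_lhs => rw [qcomm.eq_def q c a]
      rw [← mul_assoc a, yb]
      simp only [mul_sub, mul_smul_comm, smul_mul_assoc, ← mul_assoc]
    have p2 : qcomm q b a * qcomm q c a = q⁻¹ • (b * qcomm q c a * a - a * (b * qcomm q c a)) := by
      conv_lhs => rw [qcomm.eq_def q b a, sub_mul, mul_assoc b, yc]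
      simp only [smul_sub, mul_smul_comm, smul_mul_assoc, ← mul_assoc]
    have p3 : qcomm q c a * qcomm q b a = qcomm q c a * b * a - a * (qcomm q c a * b) := by
      conv_lhs => rw [qcomm.eq_def q b a]
      rw [← mul_assoc a, yc]
      simp only [mul_sub, mul_smul_comm, smul_mul_assoc, ← mul_assoc]
    have p4 : qcomm q c a * qcomm q b a = q⁻¹ • (c * qcomm q b a * a - a * (c * qcomm q b a)) := by
      conv_lhs => rw [qcomm.eq_def q c a, sub_mul, mul_assoc c, yb]
      simp only [smul_sub, mul_smul_comm, smul_mul_assoc, ← mul_assoc]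
    have r : b * qcomm q c a - t • (c * qcomm q b a)
        = - q⁻¹ • (qcomm q b a * c - t • (qcomm q c a * b)) := by
      have e1 := congrArg (fun z => z * a) hbc
      have e2 := congrArg (fun z => a * z) hbc
      simp only [qcomm, mul_sub, sub_mul, mul_smul_comm, smul_mul_assoc, mul_assoc] at e1 e2 ⊢
      linear_combination (norm := (match_scalars <;> field_simp <;> ring)) e1 - q⁻¹ ^ 2 • e2
    have r1 := congrArg (fun z => z * a) r
    have r2 := congrArg (fun z => a * z) r
    simp only [mul_sub, sub_mul, mul_smul_comm, smul_mul_assoc] at r1 r2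
    linear_combination (norm := (match_scalars <;> field_simp <;> ring))
      p1 - t • p3 + q ^ 2 • p2 - (q ^ 2 * t) • p4 + q • r1 - q • r2
  have := (smul_eq_zero_iff_right (M := A) hq2).1 key
  exact sub_eq_zero.1 this

theorem serre_qcomm_left (hq : q ≠ 0) (hq2 : q ^ 2 + 1 ≠ 0) {a b c : A} (hac : a * c = c * a)
    (hb : a * a * b - (q + q⁻¹) • (a * b * a) + b * a * a = 0)
    (hbc : b * b * c - (q + q⁻¹) • (b * c * b) + c * b * b = 0) :
    qcomm q b a * qcomm q b a * c - (q + q⁻¹) • (qcomm q b a * c * qcomm q b a)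
      + c * qcomm q b a * qcomm q b a = 0 := by
  set g := b * c - q • (c * b) with hg
  have hac' (z : A) : a * (c * z) = c * (a * z) := by rw [← mul_assoc, hac, mul_assoc]
  have h1 : b * g = q⁻¹ • (g * b) := by
    simp only [hg, mul_sub, sub_mul, mul_smul_comm, smul_mul_assoc, ← mul_assoc]
    linear_combination (norm := (match_scalars <;> field_simp <;> ring)) hbc
  have h2 : a * a * g - (q + q⁻¹) • (a * g * a) + g * a * a = 0 := by
    have e1 := congrArg (fun z => z * c) hb
    have e2 := congrArg (fun z => c * z) hb
    simp only [hg, mul_sub, sub_mul, mul_add, add_mul, mul_smul_comm, smul_mul_assoc, mul_assoc,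
      hac, hac', zero_mul, mul_zero] at e1 e2 ⊢
    linear_combination (norm := (match_scalars <;> field_simp <;> ring)) e1 - q • e2
  have h3 := qcomm_qcomm hq hq2 h1 hb h2
  have h4 : qcomm q g a = qcomm q b a * c - q • (c * qcomm q b a) := by
    simp only [qcomm, hg, mul_sub, sub_mul, mul_smul_comm, smul_mul_assoc, mul_assoc, hac, hac']
    match_scalars <;> field_simp
  rw [h4] at h3
  simp only [mul_sub, sub_mul, mul_smul_comm, smul_mul_assoc, ← mul_assoc] at h3
  linear_combination (norm := (match_scalars <;> field_simp <;> ring)) h3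

theorem serre_qcomm_right {a b c : A} (hac : a * c = c * a)
    (hcb : c * c * b - (q + q⁻¹) • (c * b * c) + b * c * c = 0) :
    c * c * qcomm q b a - (q + q⁻¹) • (c * qcomm q b a * c) + qcomm q b a * c * c = 0 := by
  have hac' (z : A) : a * (c * z) = c * (a * z) := by rw [← mul_assoc, hac, mul_assoc]
  have e1 := congrArg (fun z => z * a) hcb
  have e2 := congrArg (fun z => a * z) hcb
  simp only [qcomm, mul_sub, sub_mul, mul_add, add_mul, mul_smul_comm, smul_mul_assoc, mul_assoc,
      hac, hac', zero_mul, mul_zero] at e1 e2 ⊢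
  linear_combination (norm := (match_scalars <;> ring)) e1 - q⁻¹ • e2

end Identities

section Identities2

variable {k A : Type*} [Field k] [Ring A] [Algebra k A] {q : k}

theorem F_mul_qcomm (hq : q ≠ 0) (hd : q - q⁻¹ ≠ 0) {e e' f K K' : A}
    (h : e * f - f * e = (q - q⁻¹)⁻¹ • (K - K')) (c : e' * f = f * e')
    (hK : K * e' = q⁻¹ • (e' * K)) (hK' : K' * e' = q • (e' * K')) :
    f * qcomm q e' e = qcomm q e' e * f - q⁻¹ • (e' * K) := by
  obtain ⟨d, hd'⟩ : ∃ d, d = (q - q⁻¹)⁻¹ := ⟨_, rfl⟩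
  have hd2 : d * q - d * q⁻¹ = 1 := by rw [← mul_sub, hd']; exact inv_mul_cancel₀ hd
  rw [← hd'] at h
  have c' (z : A) : e' * (f * z) = f * (e' * z) := by rw [← mul_assoc, c, mul_assoc]
  have e1 := congrArg (fun z => e' * z) h
  have e2 := congrArg (fun z => z * e') h
  simp only [qcomm, mul_sub, sub_mul, mul_smul_comm, smul_mul_assoc, mul_assoc, c, c', hK, hK',
    smul_sub] at e1 e2 ⊢
  linear_combination (norm := skip) q⁻¹ • e2 - e1 - (hd2 * q⁻¹) • (e' * K)
  match_scalars <;> field_simp <;> ring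

theorem F_mul_qcomm' (hq : q ≠ 0) (hd : q - q⁻¹ ≠ 0) {e e' f' L L' : A}
    (h : e' * f' - f' * e' = (q - q⁻¹)⁻¹ • (L - L')) (c : e * f' = f' * e)
    (hL : L * e = q⁻¹ • (e * L)) (hL' : L' * e = q • (e * L')) :
    f' * qcomm q e' e = qcomm q e' e * f' + e * L' := by
  obtain ⟨d, hd'⟩ : ∃ d, d = (q - q⁻¹)⁻¹ := ⟨_, rfl⟩
  have hd2 : d * q - d * q⁻¹ = 1 := by rw [← mul_sub, hd']; exact inv_mul_cancel₀ hd
  rw [← hd'] at h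
  have c' (z : A) : e * (f' * z) = f' * (e * z) := by rw [← mul_assoc, c, mul_assoc]
  have e1 := congrArg (fun z => e * z) h
  have e2 := congrArg (fun z => z * e) h
  simp only [qcomm, mul_sub, sub_mul, mul_smul_comm, smul_mul_assoc, mul_assoc, c, c', hL, hL',
    smul_sub] at e1 e2 ⊢
  linear_combination (norm := skip) q⁻¹ • e1 - e2 + hd2 • (e * L')
  match_scalars <;> field_simp <;> ring

theorem E_mul_qcomm (hq : q ≠ 0) (hd : q - q⁻¹ ≠ 0) {e f f' K K' : A}
    (h : e * f - f * e = (q - q⁻¹)⁻¹ • (K - K')) (c : e * f' = f' * e)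
    (hK : K * f' = q • (f' * K)) (hK' : K' * f' = q⁻¹ • (f' * K')) :
    e * qcomm q f' f = qcomm q f' f * e - q⁻¹ • (f' * K') := by
  obtain ⟨d, hd'⟩ : ∃ d, d = (q - q⁻¹)⁻¹ := ⟨_, rfl⟩
  have hd2 : d * q - d * q⁻¹ = 1 := by rw [← mul_sub, hd']; exact inv_mul_cancel₀ hd
  rw [← hd'] at h
  have c' (z : A) : e * (f' * z) = f' * (e * z) := by rw [← mul_assoc, c, mul_assoc]
  have e1 := congrArg (fun z => f' * z) h
  have e2 := congrArg (fun z => z * f') h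
  simp only [qcomm, mul_sub, sub_mul, mul_smul_comm, smul_mul_assoc, mul_assoc, c, c', hK, hK',
    smul_sub] at e1 e2 ⊢
  linear_combination (norm := skip) e1 - q⁻¹ • e2 - (hd2 * q⁻¹) • (f' * K')
  match_scalars <;> field_simp <;> ring

theorem smul_serre {x y : A} (c d : k)
    (h : x * x * y - (q + q⁻¹) • (x * y * x) + y * x * x = 0) :
    (c • x) * (c • x) * (d • y) - (q + q⁻¹) • ((c • x) * (d • y) * (c • x))
      + (d • y) * (c • x) * (c • x) = 0 := by
  have h2 : (c • x) * (c • x) * (d • y) - (q + q⁻¹) • ((c • x) * (d • y) * (c • x))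
      + (d • y) * (c • x) * (c • x)
      = (c * c * d) • (x * x * y - (q + q⁻¹) • (x * y * x) + y * x * x) := by
    simp only [smul_mul_assoc, mul_smul_comm, smul_sub, smul_add]
    module
  rw [h2, h, smul_zero]

theorem qcomm_bracket (hq : q ≠ 0) {Y f g ef fe eg ge : A} {d : k} {a b a' b' : A}
    (e3 : f * g * Y = Y * (f * g) - eg + fe)
    (e4 : g * f * Y = Y * (g * f) + q⁻¹ • ef - q⁻¹ • ge)
    (e5 : eg - ge = d • (a - a')) (e6 : ef - fe = d • (b - b')) (e7 : a' = b) :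
    Y * ((-q) • qcomm q g f) - ((-q) • qcomm q g f) * Y = d • (a - b') := by
  subst e7
  simp only [qcomm, mul_smul_comm, smul_mul_assoc, mul_sub, sub_mul, e3, e4]
  linear_combination (norm := skip) e5 + e6
  match_scalars <;> field_simp <;> ring

end Identities2

/-- The ground field `ℚ(v)`. -/
abbrev Qv : Type := RatFunc ℚ

/-- The indeterminate `v` of `ℚ(v)`. -/
noncomputable abbrev vv : Qv := RatFunc.X

/-- The vertex set `Q₀ = {1, …, n}`. -/
abbrev Vertex (n : ℕ) : Type := {i : ℕ // 1 ≤ i ∧ i ≤ n}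

/-- `|i - j| = 1`. -/
def Adj {n : ℕ} (i j : Vertex n) : Prop := i.1 + 1 = j.1 ∨ j.1 + 1 = i.1

/-- `|i - j| ≥ 2`. -/
def Far {n : ℕ} (i j : Vertex n) : Prop := i.1 + 2 ≤ j.1 ∨ j.1 + 2 ≤ i.1

instance {n : ℕ} (i j : Vertex n) : Decidable (Adj i j) := by unfold Adj; infer_instance

/-- The entries of the Cartan matrix of type `A_n`. -/
def cartan {n : ℕ} (i j : Vertex n) : ℤ := if i = j then 2 else if Adj i j then -1 else 0

/-- The generators of the quantized enveloping algebra; `Kinv i` stands for `K_i⁻¹`. -/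
inductive Gen (n : ℕ) : Type
  | E (i : Vertex n)
  | F (i : Vertex n)
  | K (i : Vertex n)
  | Kinv (i : Vertex n)

/-- The free `ℚ(v)`-algebra on the generators. -/
abbrev Free (n : ℕ) : Type := FreeAlgebra Qv (Gen n)

/-- A generator, as an element of the free algebra. -/
noncomputable abbrev gen {n : ℕ} (g : Gen n) : Free n := FreeAlgebra.ι Qv g

/-- The defining relations of the quantized enveloping algebra of `𝔰𝔩_{n+1}`. -/
inductive Rel (n : ℕ) : Free n → Free n → Prop
  | K_mul_K (i j : Vertex n) :
      Rel n (gen (.K i) * gen (.K j)) (gen (.K j) * gen (.K i))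
  | K_mul_Kinv (i : Vertex n) : Rel n (gen (.K i) * gen (.Kinv i)) 1
  | Kinv_mul_K (i : Vertex n) : Rel n (gen (.Kinv i) * gen (.K i)) 1
  | K_E (i j : Vertex n) :
      Rel n (gen (.K i) * gen (.E j) * gen (.Kinv i)) (vv ^ cartan i j • gen (.E j))
  | K_F (i j : Vertex n) :
      Rel n (gen (.K i) * gen (.F j) * gen (.Kinv i)) (vv ^ (-cartan i j) • gen (.F j))
  | E_F_same (i : Vertex n) :
      Rel n (gen (.E i) * gen (.F i) - gen (.F i) * gen (.E i))
        ((vv - vv⁻¹)⁻¹ • (gen (.K i) - gen (.Kinv i)))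
  | E_F_ne (i j : Vertex n) (h : i ≠ j) :
      Rel n (gen (.E i) * gen (.F j) - gen (.F j) * gen (.E i)) 0
  | serre_E (i j : Vertex n) (h : Adj i j) :
      Rel n (gen (.E i) * gen (.E i) * gen (.E j)
        - (vv + vv⁻¹) • (gen (.E i) * gen (.E j) * gen (.E i))
        + gen (.E j) * gen (.E i) * gen (.E i)) 0
  | serre_F (i j : Vertex n) (h : Adj i j) :
      Rel n (gen (.F i) * gen (.F i) * gen (.F j)
        - (vv + vv⁻¹) • (gen (.F i) * gen (.F j) * gen (.F i))
        + gen (.F j) * gen (.F i) * gen (.F i)) 0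
  | comm_E (i j : Vertex n) (h : Far i j) :
      Rel n (gen (.E i) * gen (.E j)) (gen (.E j) * gen (.E i))
  | comm_F (i j : Vertex n) (h : Far i j) :
      Rel n (gen (.F i) * gen (.F j)) (gen (.F j) * gen (.F i))

/-- The quantized enveloping algebra `U_v(𝔤)` for `𝔤 = 𝔰𝔩_{n+1}`. -/
def U (n : ℕ) : Type := RingQuot (Rel n)

noncomputable instance (n : ℕ) : Ring (U n) := inferInstanceAs (Ring (RingQuot (Rel n)))

noncomputable instance (n : ℕ) : Algebra Qv (U n) :=
  inferInstanceAs (Algebra Qv (RingQuot (Rel n)))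

/-- The quotient map from the free algebra onto `U_v(𝔤)`. -/
noncomputable def proj (n : ℕ) : Free n →ₐ[Qv] U n := RingQuot.mkAlgHom Qv (Rel n)

theorem proj_rel {n : ℕ} {x y : Free n} (h : Rel n x y) : proj n x = proj n y :=
  RingQuot.mkAlgHom_rel Qv h

/-- The image of a generator in `U_v(𝔤)`. -/
noncomputable def mk {n : ℕ} (g : Gen n) : U n := proj n (gen g)

section Relations

variable {n : ℕ}

theorem vv_ne_zero : vv ≠ 0 := RatFunc.X_ne_zero

theorem vv_ne : vv ^ 2 + 1 ≠ 0 ∧ vv - vv⁻¹ ≠ 0 := by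
  have key (c : ℚ) : vv ^ 2 + RatFunc.C c ≠ 0 := by
    have h : vv ^ 2 + RatFunc.C c
        = algebraMap (Polynomial ℚ) Qv (Polynomial.X ^ 2 + Polynomial.C c) := by
      simp [RatFunc.algebraMap_X, RatFunc.algebraMap_C]
    rw [h]
    exact RatFunc.algebraMap_ne_zero (Polynomial.X_pow_add_C_ne_zero (by norm_num) c)
  refine ⟨by simpa using key 1, fun h => key (-1) ?_⟩
  have h2 : vv * vv⁻¹ = 1 := mul_inv_cancel₀ vv_ne_zero
  have h3 : vv * (vv - vv⁻¹) = 0 := by rw [h, mul_zero]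
  rw [mul_sub, h2] at h3
  rw [map_neg, map_one, pow_two, ← sub_eq_add_neg, h3]

theorem K_mul_K (i j : Vertex n) : mk (.K i) * mk (.K j) = mk (.K j) * mk (.K i) := by
  simpa [mk] using proj_rel (Rel.K_mul_K i j)

theorem K_mul_Kinv (i : Vertex n) : mk (.K i) * mk (.Kinv i) = 1 := by
  simpa [mk] using proj_rel (Rel.K_mul_Kinv i)

theorem Kinv_mul_K (i : Vertex n) : mk (.Kinv i) * mk (.K i) = 1 := by
  simpa [mk] using proj_rel (Rel.Kinv_mul_K i)

theorem E_F_same (i : Vertex n) : mk (.E i) * mk (.F i) - mk (.F i) * mk (.E i)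
    = (vv - vv⁻¹)⁻¹ • (mk (.K i) - mk (.Kinv i)) := by
  simpa [mk] using proj_rel (Rel.E_F_same i)

theorem E_F_ne (i j : Vertex n) (h : i ≠ j) :
    mk (.E i) * mk (.F j) = mk (.F j) * mk (.E i) := by
  simpa [mk, sub_eq_zero] using proj_rel (Rel.E_F_ne i j h)

theorem serre_E (i j : Vertex n) (h : Adj i j) :
    mk (.E i) * mk (.E i) * mk (.E j) - (vv + vv⁻¹) • (mk (.E i) * mk (.E j) * mk (.E i))
      + mk (.E j) * mk (.E i) * mk (.E i) = 0 := by
  simpa [mk] using proj_rel (Rel.serre_E i j h)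

theorem serre_F (i j : Vertex n) (h : Adj i j) :
    mk (.F i) * mk (.F i) * mk (.F j) - (vv + vv⁻¹) • (mk (.F i) * mk (.F j) * mk (.F i))
      + mk (.F j) * mk (.F i) * mk (.F i) = 0 := by
  simpa [mk] using proj_rel (Rel.serre_F i j h)

theorem comm_E (i j : Vertex n) (h : Far i j) :
    mk (.E i) * mk (.E j) = mk (.E j) * mk (.E i) := by
  simpa [mk] using proj_rel (Rel.comm_E i j h)

theorem comm_F (i j : Vertex n) (h : Far i j) :
    mk (.F i) * mk (.F j) = mk (.F j) * mk (.F i) := by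
  simpa [mk] using proj_rel (Rel.comm_F i j h)

/-- `K_i` as a unit of `U_v(𝔤)`. -/
noncomputable def Kunit (i : Vertex n) : (U n)ˣ where
  val := mk (.K i)
  inv := mk (.Kinv i)
  val_inv := K_mul_Kinv i
  inv_val := Kinv_mul_K i

theorem Kunit_comm (i j : Vertex n) : Commute (Kunit i) (Kunit j) := by
  apply Units.ext
  exact K_mul_K i j

theorem Kunit_one (i : Vertex n) : ((Kunit i ^ (1 : ℤ) : (U n)ˣ) : U n) = mk (.K i) := by
  simp [Kunit]

theorem Kunit_neg_one (i : Vertex n) : ((Kunit i ^ (-1 : ℤ) : (U n)ˣ) : U n) = mk (.Kinv i) := by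
  simp [Kunit]

/-- `x` is homogeneous: `K_j x = v^(m j) x K_j` for all `j`. -/
def HasWt (x : U n) (m : Vertex n → ℤ) : Prop :=
  ∀ j, mk (.K j) * x = vv ^ m j • (x * mk (.K j))

theorem HasWt.mul {x y : U n} {m p : Vertex n → ℤ} (hx : HasWt x m) (hy : HasWt y p) :
    HasWt (x * y) (fun j => m j + p j) := fun j => by
  rw [← mul_assoc, hx j, smul_mul_assoc, mul_assoc, hy j, mul_smul_comm, smul_smul,
    zpow_add₀ vv_ne_zero, mul_assoc]

theorem HasWt.sub {x y : U n} {m : Vertex n → ℤ} (hx : HasWt x m) (hy : HasWt y m) :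
    HasWt (x - y) m := fun j => by
  rw [mul_sub, hx j, hy j, sub_mul, smul_sub]

theorem HasWt.smul {x : U n} {m : Vertex n → ℤ} (c : Qv) (hx : HasWt x m) :
    HasWt (c • x) m := fun j => by
  rw [mul_smul_comm, hx j, smul_mul_assoc, smul_comm]

theorem HasWt.neg {x : U n} {m : Vertex n → ℤ} (hx : HasWt x m) :
    HasWt (-x) m := fun j => by
  rw [mul_neg, hx j, neg_mul, smul_neg]

theorem HasWt.congr {x : U n} {m p : Vertex n → ℤ} (hx : HasWt x m) (h : ∀ j, m j = p j) :
    HasWt x p := fun j => by rw [hx j, h j]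

theorem hasWt_E (i : Vertex n) : HasWt (mk (.E i)) (fun j => cartan j i) := fun j => by
  have h : mk (.K j) * mk (.E i) * mk (.Kinv j) = vv ^ cartan j i • mk (.E i) := by
    simpa [mk] using proj_rel (Rel.K_E j i)
  have h2 := congrArg (fun z => z * mk (.K j)) h
  simpa [mul_assoc, Kinv_mul_K] using h2

theorem hasWt_F (i : Vertex n) : HasWt (mk (.F i)) (fun j => -cartan j i) := fun j => by
  have h : mk (.K j) * mk (.F i) * mk (.Kinv j) = vv ^ (-cartan j i) • mk (.F i) := by
    simpa [mk] using proj_rel (Rel.K_F j i)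
  have h2 := congrArg (fun z => z * mk (.K j)) h
  simpa [mul_assoc, Kinv_mul_K] using h2

theorem hasWt_K (i : Vertex n) : HasWt (mk (.K i)) (fun _ => 0) := fun j => by
  simp [K_mul_K j i]

theorem Kunit_mul {x : U n} {m : Vertex n → ℤ} (hx : HasWt x m) (j : Vertex n) (e : ℤ) :
    ((Kunit j ^ e : (U n)ˣ) : U n) * x = vv ^ (e * m j) • (x * ((Kunit j ^ e : (U n)ˣ) : U n)) := by
  have h1 : mk (.K j) * x = vv ^ m j • (x * mk (.K j)) := hx j
  have h2 : mk (.Kinv j) * x = vv ^ (-m j) • (x * mk (.Kinv j)) := by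
    have := congrArg (fun z => mk (.Kinv j) * z * mk (.Kinv j)) h1
    simp only [← mul_assoc, Kinv_mul_K, one_mul, mul_smul_comm, smul_mul_assoc] at this
    simp only [mul_assoc, K_mul_Kinv, mul_one] at this
    rw [this, smul_smul, ← zpow_add₀ vv_ne_zero]
    simp
  induction e with
  | zero => simp
  | succ e ih =>
    rw [zpow_add_one, Units.val_mul, mul_assoc]
    change _ * (mk (.K j) * x) = _ • (_ * (_ * mk (.K j)))
    rw [h1, mul_smul_comm, ← mul_assoc, ih, smul_mul_assoc, smul_smul, mul_assoc,
      ← zpow_add₀ vv_ne_zero]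
    congr 2
    ring
  | pred e ih =>
    rw [zpow_sub_one, Units.val_mul, mul_assoc]
    change _ * (mk (.Kinv j) * x) = _ • (_ * (_ * mk (.Kinv j)))
    rw [h2, mul_smul_comm, ← mul_assoc, ih, smul_mul_assoc, smul_smul, mul_assoc,
      ← zpow_add₀ vv_ne_zero]
    congr 2
    ring

theorem hasWt_Kunit (i : Vertex n) (e : ℤ) :
    HasWt ((Kunit i ^ e : (U n)ˣ) : U n) (fun _ => 0) := fun j => by
  have := Kunit_mul (hasWt_K j) i e
  simpa using this.symm

theorem cartan_self (i : Vertex n) : cartan i i = 2 := by simp [cartan]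

theorem Adj.ne {i j : Vertex n} (h : Adj i j) : i ≠ j := by
  rintro rfl; unfold Adj at h; omega

theorem Adj.symm {i j : Vertex n} (h : Adj i j) : Adj j i := by unfold Adj at *; omega

theorem Far.symm {i j : Vertex n} (h : Far i j) : Far j i := by unfold Far at *; omega

theorem Far.ne {i j : Vertex n} (h : Far i j) : i ≠ j := by
  rintro rfl; unfold Far at h; omega

theorem Far.not_adj {i j : Vertex n} (h : Far i j) : ¬ Adj i j := by
  unfold Adj; unfold Far at h; omega

theorem trichotomy (i j : Vertex n) : i = j ∨ Adj i j ∨ Far i j := by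
  unfold Adj Far; rw [Subtype.ext_iff]; omega

theorem cartan_adj {i j : Vertex n} (h : Adj i j) : cartan i j = -1 := by simp [cartan, h.ne, h]

theorem cartan_far {i j : Vertex n} (h : Far i j) : cartan i j = 0 := by
  simp [cartan, h.ne, h.not_adj]

theorem cartan_comm (i j : Vertex n) : cartan i j = cartan j i := by
  rcases trichotomy i j with rfl | h | h
  · rfl
  · rw [cartan_adj h, cartan_adj h.symm]
  · rw [cartan_far h, cartan_far h.symm]

end Relations

section Braid

variable {n : ℕ}

/-- The value `T_i(E_j)`. -/
noncomputable def tE (i j : Vertex n) : U n :=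
  if i = j then -(mk (.Kinv i) * mk (.F i))
  else if Adj i j then mk (.E j) * mk (.E i) - vv⁻¹ • (mk (.E i) * mk (.E j))
  else mk (.E j)

/-- The value `T_i(F_j)`. -/
noncomputable def tF (i j : Vertex n) : U n :=
  if i = j then -(mk (.E i) * mk (.K i))
  else if Adj i j then mk (.F i) * mk (.F j) - vv • (mk (.F j) * mk (.F i))
  else mk (.F j)

/-- The value `T_i(K_j) = K_j K_i^(-a_ij)`. -/
noncomputable def tK (i j : Vertex n) : U n :=
  mk (.K j) * ((Kunit i ^ (-cartan i j) : (U n)ˣ) : U n)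

/-- The value `T_i(K_j⁻¹) = K_j⁻¹ K_i^(a_ij)`. -/
noncomputable def tKinv (i j : Vertex n) : U n :=
  mk (.Kinv j) * ((Kunit i ^ cartan i j : (U n)ˣ) : U n)

theorem tE_self (i : Vertex n) : tE i i = -(mk (.Kinv i) * mk (.F i)) := by simp [tE]

theorem tE_adj {i j : Vertex n} (h : Adj i j) : tE i j = qcomm vv (mk (.E j)) (mk (.E i)) := by
  simp [tE, h, h.ne, qcomm]

theorem tE_far {i j : Vertex n} (h : Far i j) : tE i j = mk (.E j) := by
  simp [tE, h.not_adj, h.ne]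

theorem tF_self (i : Vertex n) : tF i i = -(mk (.E i) * mk (.K i)) := by simp [tF]

theorem tF_adj {i j : Vertex n} (h : Adj i j) :
    tF i j = (-vv) • qcomm vv (mk (.F j)) (mk (.F i)) := by
  have hv := vv_ne_zero
  simp only [tF, h, h.ne, qcomm, if_true, if_false, smul_sub, smul_smul, neg_mul,
    mul_inv_cancel₀ hv, neg_smul, one_smul]
  abel

theorem tF_far {i j : Vertex n} (h : Far i j) : tF i j = mk (.F j) := by
  simp [tF, h.not_adj, h.ne]

theorem tK_eq (i j : Vertex n) : tK i j = ((Kunit j * Kunit i ^ (-cartan i j) : (U n)ˣ) : U n) := by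
  simp [tK, Kunit]

theorem tKinv_eq (i j : Vertex n) :
    tKinv i j = (((Kunit j * Kunit i ^ (-cartan i j))⁻¹ : (U n)ˣ) : U n) := by
  have h : (Kunit j * Kunit i ^ (-cartan i j))⁻¹ = (Kunit j)⁻¹ * Kunit i ^ cartan i j := by
    rw [mul_inv_rev, zpow_neg, inv_inv]
    exact (((Kunit_comm i j).zpow_left _).inv_right).eq
  rw [h, Units.val_mul]
  rfl

theorem tK_mul_tK (i j l : Vertex n) : tK i j * tK i l = tK i l * tK i j := by
  rw [tK_eq, tK_eq, ← Units.val_mul, ← Units.val_mul]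
  congr 1
  have h1 : Commute (Kunit j * Kunit i ^ (-cartan i j)) (Kunit l) :=
    (Kunit_comm j l).mul_left ((Kunit_comm i l).zpow_left _)
  have h2 : Commute (Kunit j * Kunit i ^ (-cartan i j)) (Kunit i) :=
    (Kunit_comm j i).mul_left ((Kunit_comm i i).zpow_left _)
  exact (h1.mul_right (h2.zpow_right _)).eq

theorem tK_mul_tKinv (i j : Vertex n) : tK i j * tKinv i j = 1 := by
  rw [tK_eq, tKinv_eq, ← Units.val_mul, mul_inv_cancel, Units.val_one]

theorem tKinv_mul_tK (i j : Vertex n) : tKinv i j * tK i j = 1 := by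
  rw [tK_eq, tKinv_eq, ← Units.val_mul, inv_mul_cancel, Units.val_one]

theorem tK_conj {x : U n} {m : Vertex n → ℤ} (hx : HasWt x m) (i j : Vertex n) :
    tK i j * x * tKinv i j = vv ^ (m j - cartan i j * m i) • x := by
  have h : tK i j * x = vv ^ (m j - cartan i j * m i) • (x * tK i j) := by
    rw [tK, mul_assoc, Kunit_mul hx, mul_smul_comm, ← mul_assoc, hx j, smul_mul_assoc, smul_smul,
      mul_assoc, ← zpow_add₀ vv_ne_zero]
    congr 2
    ring
  rw [h, smul_mul_assoc, mul_assoc, tK_mul_tKinv, mul_one]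

theorem hasWt_Kinv (i : Vertex n) : HasWt (mk (.Kinv i)) (fun _ => 0) := by
  have := hasWt_Kunit i (-1)
  rwa [Kunit_neg_one] at this

theorem hasWt_tE (i j : Vertex n) :
    HasWt (tE i j) (fun l => cartan l j - cartan l i * cartan i j) := by
  rcases trichotomy i j with rfl | h | h
  · rw [tE_self]
    refine (((hasWt_Kinv i).mul (hasWt_F i)).neg).congr fun l => ?_
    simp only [cartan_self]; ring
  · rw [tE_adj h, qcomm]
    refine HasWt.sub (((hasWt_E j).mul (hasWt_E i)).congr fun l => ?_)
      ((((hasWt_E i).mul (hasWt_E j)).smul _).congr fun l => ?_) <;> rw [cartan_adj h] <;> ring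
  · rw [tE_far h]
    refine (hasWt_E j).congr fun l => ?_
    rw [cartan_far h]; ring

theorem hasWt_tF (i j : Vertex n) :
    HasWt (tF i j) (fun l => -(cartan l j - cartan l i * cartan i j)) := by
  rcases trichotomy i j with rfl | h | h
  · rw [tF_self]
    refine (((hasWt_E i).mul (hasWt_K i)).neg).congr fun l => ?_
    simp only [cartan_self]; ring
  · rw [tF_adj h, qcomm]
    refine (HasWt.sub (((hasWt_F j).mul (hasWt_F i)).congr fun l => ?_)
      ((((hasWt_F i).mul (hasWt_F j)).smul _).congr fun l => ?_)).smul _ <;>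
      rw [cartan_adj h] <;> ring
  · rw [tF_far h]
    refine (hasWt_F j).congr fun l => ?_
    rw [cartan_far h]; ring

theorem tK_tE (i j l : Vertex n) : tK i j * tE i l * tKinv i j = vv ^ cartan j l • tE i l := by
  rw [tK_conj (hasWt_tE i l)]
  congr 2
  rw [cartan_self, cartan_comm j i]; ring

theorem tK_tF (i j l : Vertex n) : tK i j * tF i l * tKinv i j = vv ^ (-cartan j l) • tF i l := by
  rw [tK_conj (hasWt_tF i l)]
  congr 2
  rw [cartan_self, cartan_comm j i]; ring

theorem K_E_adj {i j : Vertex n} (h : Adj i j) :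
    mk (.K i) * mk (.E j) = vv⁻¹ • (mk (.E j) * mk (.K i)) := by
  have := hasWt_E j i
  simpa only [cartan_adj h, zpow_neg_one] using this

theorem K_F_adj {i j : Vertex n} (h : Adj i j) :
    mk (.K i) * mk (.F j) = vv • (mk (.F j) * mk (.K i)) := by
  have := hasWt_F j i
  simpa only [cartan_adj h, neg_neg, zpow_one] using this

theorem Kinv_mul {x : U n} {m : Vertex n → ℤ} (hx : HasWt x m) (j : Vertex n) :
    mk (.Kinv j) * x = vv ^ (-m j) • (x * mk (.Kinv j)) := by
  have := Kunit_mul hx j (-1)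
  rwa [Kunit_neg_one, neg_one_mul] at this

theorem Kinv_E_adj {i j : Vertex n} (h : Adj i j) :
    mk (.Kinv i) * mk (.E j) = vv • (mk (.E j) * mk (.Kinv i)) := by
  have := Kinv_mul (hasWt_E j) i
  simpa only [cartan_adj h, neg_neg, zpow_one] using this

theorem Kinv_F_adj {i j : Vertex n} (h : Adj i j) :
    mk (.Kinv i) * mk (.F j) = vv⁻¹ • (mk (.F j) * mk (.Kinv i)) := by
  have := Kinv_mul (hasWt_F j) i
  simpa only [cartan_adj h, neg_neg, zpow_neg_one] using this

theorem K_qE {i j : Vertex n} (h : Adj i j) :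
    mk (.K i) * qcomm vv (mk (.E j)) (mk (.E i)) =
      vv • (qcomm vv (mk (.E j)) (mk (.E i)) * mk (.K i)) := by
  have := hasWt_tE i j i
  simp only [tE_adj h, cartan_self, cartan_adj h] at this
  simpa using this

theorem Kinv_qE {i j : Vertex n} (h : Adj i j) :
    mk (.Kinv i) * qcomm vv (mk (.E j)) (mk (.E i)) =
      vv⁻¹ • (qcomm vv (mk (.E j)) (mk (.E i)) * mk (.Kinv i)) := by
  have := Kinv_mul (hasWt_tE i j) i
  simp only [tE_adj h, cartan_self, cartan_adj h] at this
  simpa using this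

theorem hasWt_qF (i j : Vertex n) :
    HasWt (qcomm vv (mk (.F j)) (mk (.F i))) (fun l => -cartan l j - cartan l i) := by
  refine HasWt.sub (((hasWt_F j).mul (hasWt_F i)).congr fun l => ?_)
      ((((hasWt_F i).mul (hasWt_F j)).smul _).congr fun l => ?_) <;> ring

theorem K_qF {i j : Vertex n} (h : Adj i j) :
    mk (.K i) * qcomm vv (mk (.F j)) (mk (.F i)) =
      vv⁻¹ • (qcomm vv (mk (.F j)) (mk (.F i)) * mk (.K i)) := by
  have := hasWt_qF i j i
  simp only [cartan_self, cartan_adj h] at this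
  simpa using this

theorem Kinv_qF {i j : Vertex n} (h : Adj i j) :
    mk (.Kinv i) * qcomm vv (mk (.F j)) (mk (.F i)) =
      vv • (qcomm vv (mk (.F j)) (mk (.F i)) * mk (.Kinv i)) := by
  have := Kinv_mul (hasWt_qF i j) i
  simp only [cartan_self, cartan_adj h] at this
  simpa using this

theorem F_qE {i j : Vertex n} (h : Adj i j) :
    mk (.F i) * qcomm vv (mk (.E j)) (mk (.E i)) =
      qcomm vv (mk (.E j)) (mk (.E i)) * mk (.F i) - vv⁻¹ • (mk (.E j) * mk (.K i)) :=
  F_mul_qcomm vv_ne_zero vv_ne.2 (E_F_same i) (E_F_ne j i h.symm.ne) (K_E_adj h) (Kinv_E_adj h)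

theorem F_qE' {i j : Vertex n} (h : Adj i j) :
    mk (.F j) * qcomm vv (mk (.E j)) (mk (.E i)) =
      qcomm vv (mk (.E j)) (mk (.E i)) * mk (.F j) + mk (.E i) * mk (.Kinv j) :=
  F_mul_qcomm' vv_ne_zero vv_ne.2 (E_F_same j) (E_F_ne i j h.ne) (K_E_adj h.symm)
    (Kinv_E_adj h.symm)

theorem E_qF {i j : Vertex n} (h : Adj i j) :
    mk (.E i) * qcomm vv (mk (.F j)) (mk (.F i)) =
      qcomm vv (mk (.F j)) (mk (.F i)) * mk (.E i) - vv⁻¹ • (mk (.F j) * mk (.Kinv i)) :=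
  E_mul_qcomm vv_ne_zero vv_ne.2 (E_F_same i) (E_F_ne i j h.ne) (K_F_adj h) (Kinv_F_adj h)

theorem tE_self_mul {i j : Vertex n} (h : Adj i j) :
    tE i i * tE i j = vv⁻¹ • (tE i j * tE i i) + (1 : Qv) • mk (.E j) := by
  have hv := vv_ne_zero
  rw [tE_self, tE_adj h, neg_mul, mul_assoc, F_qE h, mul_sub, ← mul_assoc, Kinv_qE h,
    mul_smul_comm, ← mul_assoc, Kinv_E_adj h, smul_mul_assoc, smul_mul_assoc, mul_assoc, mul_assoc,
    Kinv_mul_K, mul_one, smul_smul, inv_mul_cancel₀ hv, mul_neg, smul_neg, neg_sub, sub_eq_neg_add]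

theorem tE_self_E {i j : Vertex n} (h : Adj i j) :
    tE i i * mk (.E j) = vv • (mk (.E j) * tE i i) := by
  rw [tE_self, neg_mul, mul_assoc, ← E_F_ne j i h.symm.ne, ← mul_assoc, Kinv_E_adj h,
    smul_mul_assoc, mul_assoc, mul_neg, smul_neg]

theorem tF_self_mul {i j : Vertex n} (h : Adj i j) :
    tF i i * qcomm vv (mk (.F j)) (mk (.F i)) =
      vv⁻¹ • (qcomm vv (mk (.F j)) (mk (.F i)) * tF i i) + (vv⁻¹ * vv⁻¹) • mk (.F j) := by
  rw [tF_self, neg_mul, mul_assoc, K_qF h, mul_smul_comm, ← mul_assoc, E_qF h, sub_mul,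
    smul_mul_assoc, mul_assoc, mul_assoc, Kinv_mul_K, mul_one, mul_neg, smul_sub, smul_neg,
    smul_smul, neg_sub, sub_eq_add_neg, add_comm]

theorem tF_self_F {i j : Vertex n} (h : Adj i j) :
    tF i i * mk (.F j) = vv • (mk (.F j) * tF i i) := by
  rw [tF_self, neg_mul, mul_assoc, K_F_adj h, mul_smul_comm, ← mul_assoc, E_F_ne i j h.ne,
    mul_assoc, mul_neg, smul_neg]

theorem not_adj_adj {i j l : Vertex n} (h1 : Adj i j) (h2 : Adj i l) : ¬ Adj j l := by
  unfold Adj at *; omega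

theorem adj_adj {i j l : Vertex n} (h1 : Adj i j) (h2 : Adj i l) : j = l ∨ Far j l := by
  rcases trichotomy j l with h | h | h
  · exact .inl h
  · exact absurd h (not_adj_adj h1 h2)
  · exact .inr h

theorem tE_serre (i j l : Vertex n) (h : Adj j l) :
    tE i j * tE i j * tE i l - (vv + vv⁻¹) • (tE i j * tE i l * tE i j)
      + tE i l * tE i j * tE i j = 0 := by
  have hv := vv_ne_zero
  rcases trichotomy i j with rfl | h1 | h1
  · exact serre_left hv (tE_self_mul h) (tE_self_E h)
  · rcases trichotomy i l with rfl | h2 | h2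
    · refine serre_right hv (tE_self_mul h1) ?_
      rw [tE_adj h1]
      exact mul_qcomm' hv (serre_E j i h)
    · exact absurd h (not_adj_adj h1 h2)
    · rw [tE_adj h1, tE_far h2]
      exact serre_qcomm_left hv vv_ne.1 (comm_E i l h2) (serre_E i j h1) (serre_E j l h)
  · rcases trichotomy i l with rfl | h2 | h2
    · exact absurd h.symm h1.not_adj
    · rw [tE_adj h2, tE_far h1]
      exact serre_qcomm_right (comm_E i j h1) (serre_E j l h)
    · rw [tE_far h1, tE_far h2]
      exact serre_E j l h

theorem tF_serre (i j l : Vertex n) (h : Adj j l) :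
    tF i j * tF i j * tF i l - (vv + vv⁻¹) • (tF i j * tF i l * tF i j)
      + tF i l * tF i j * tF i j = 0 := by
  have hv := vv_ne_zero
  rcases trichotomy i j with rfl | h1 | h1
  · rw [tF_adj h]
    simpa only [one_smul] using
      smul_serre 1 (-vv) (serre_left hv (tF_self_mul h) (tF_self_F h))
  · rcases trichotomy i l with rfl | h2 | h2
    · rw [tF_adj h1]
      simpa only [one_smul] using smul_serre (-vv) 1
        (serre_right hv (tF_self_mul h1) (mul_qcomm' hv (serre_F j i h)))
    · exact absurd h (not_adj_adj h1 h2)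
    · rw [tF_adj h1, tF_far h2]
      simpa only [one_smul] using smul_serre (-vv) 1
        (serre_qcomm_left hv vv_ne.1 (comm_F i l h2) (serre_F i j h1) (serre_F j l h))
  · rcases trichotomy i l with rfl | h2 | h2
    · exact absurd h.symm h1.not_adj
    · rw [tF_adj h2, tF_far h1]
      simpa only [one_smul] using smul_serre 1 (-vv)
        (serre_qcomm_right (comm_F i j h1) (serre_F j l h))
    · rw [tF_far h1, tF_far h2]
      exact serre_F j l h

theorem commute_qcomm {a b c : U n} (ha : Commute c a)
    (hb : Commute c b) : Commute c (qcomm vv b a) :=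
  (hb.mul_right ha).sub_right ((ha.mul_right hb).smul_right _)

theorem Kinv_comm_of_far {i j : Vertex n} (h : Far i j) {x : U n}
    (hx : ∃ s : ℤ, HasWt x (fun l => s * cartan l j)) : Commute (mk (.Kinv i)) x := by
  obtain ⟨s, hs⟩ := hx
  have := Kinv_mul hs i
  simp only [cartan_far h, mul_zero, neg_zero, zpow_zero, one_smul] at this
  exact this

theorem K_comm_of_far {i j : Vertex n} (h : Far i j) {x : U n}
    (hx : ∃ s : ℤ, HasWt x (fun l => s * cartan l j)) : Commute (mk (.K i)) x := by
  obtain ⟨s, hs⟩ := hx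
  have := hs i
  simp only [cartan_far h, mul_zero, zpow_zero, one_smul] at this
  exact this

theorem hasWt_E' (j : Vertex n) : ∃ s : ℤ, HasWt (mk (.E j)) (fun l => s * cartan l j) :=
  ⟨1, (hasWt_E j).congr fun l => by ring⟩

theorem hasWt_F' (j : Vertex n) : ∃ s : ℤ, HasWt (mk (.F j)) (fun l => s * cartan l j) :=
  ⟨-1, (hasWt_F j).congr fun l => by ring⟩

theorem tE_comm (i j l : Vertex n) (h : Far j l) : tE i j * tE i l = tE i l * tE i j := by
  have hself {m : Vertex n} (hm : Far i m) : Commute (tE i i) (mk (.E m)) := by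
    rw [tE_self]
    exact ((Kinv_comm_of_far hm (hasWt_E' m)).mul_left (E_F_ne m i hm.symm.ne).symm).neg_left
  have hadj {a m : Vertex n} (ha : Adj i a) (hm : Far i m) (ham : Far a m) :
      Commute (mk (.E m)) (tE i a) := by
    rw [tE_adj ha]
    exact commute_qcomm (comm_E m i hm.symm) (comm_E m a ham.symm)
  rcases trichotomy i j with rfl | h1 | h1
  · rw [tE_far h]; exact hself h
  · rcases trichotomy i l with rfl | h2 | h2
    · exact absurd h1.symm h.not_adj
    · rw [tE_adj h1, tE_adj h2]
      have h3 : mk (.E j) * mk (.E l) = (1 : Qv) • (mk (.E l) * mk (.E j)) := by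
        rw [one_smul]; exact comm_E j l h
      simpa only [one_smul] using
        qcomm_qcomm vv_ne_zero vv_ne.1 h3 (serre_E i j h1) (serre_E i l h2)
    · rw [tE_far h2]; exact (hadj h1 h2 h).symm
  · rcases trichotomy i l with rfl | h2 | h2
    · rw [tE_far h1]; exact (hself h1).symm
    · rw [tE_far h1]; exact hadj h2 h1 h.symm
    · rw [tE_far h1, tE_far h2]; exact comm_E j l h

theorem tF_comm (i j l : Vertex n) (h : Far j l) : tF i j * tF i l = tF i l * tF i j := by
  have hself {m : Vertex n} (hm : Far i m) : Commute (tF i i) (mk (.F m)) := by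
    rw [tF_self]
    have e : Commute (mk (.E i)) (mk (.F m)) := E_F_ne i m hm.ne
    exact (e.mul_left (K_comm_of_far hm (hasWt_F' m))).neg_left
  have hadj {a m : Vertex n} (ha : Adj i a) (hm : Far i m) (ham : Far a m) :
      Commute (mk (.F m)) (tF i a) := by
    rw [tF_adj ha]
    exact (commute_qcomm (comm_F m i hm.symm) (comm_F m a ham.symm)).smul_right _
  rcases trichotomy i j with rfl | h1 | h1
  · rw [tF_far h]; exact hself h
  · rcases trichotomy i l with rfl | h2 | h2
    · exact absurd h1.symm h.not_adj
    · rw [tF_adj h1, tF_adj h2]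
      have h3 : mk (.F j) * mk (.F l) = (1 : Qv) • (mk (.F l) * mk (.F j)) := by
        rw [one_smul]; exact comm_F j l h
      have h4 : Commute (qcomm vv (mk (.F j)) (mk (.F i))) (qcomm vv (mk (.F l)) (mk (.F i))) := by
        have := qcomm_qcomm vv_ne_zero vv_ne.1 h3 (serre_F i j h1) (serre_F i l h2)
        rwa [one_smul] at this
      exact (h4.smul_left _).smul_right _
    · rw [tF_far h2]; exact (hadj h1 h2 h).symm
  · rcases trichotomy i l with rfl | h2 | h2
    · rw [tF_far h1]; exact (hself h1).symm
    · rw [tF_far h1]; exact hadj h2 h1 h.symm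
    · rw [tF_far h1, tF_far h2]; exact comm_F j l h

theorem tE_tF_ne (i j l : Vertex n) (h : j ≠ l) : tE i j * tF i l = tF i l * tE i j := by
  have hv := vv_ne_zero
  rcases trichotomy i j with rfl | h1 | h1
  · rcases trichotomy i l with rfl | h2 | h2
    · exact absurd rfl h
    · rw [tF_adj h2, tE_self, mul_smul_comm, smul_mul_assoc]
      congr 1
      rw [neg_mul, mul_neg, mul_assoc, mul_qcomm hv (serre_F i l h2), mul_smul_comm, ← mul_assoc,
        Kinv_qF h2, smul_mul_assoc, smul_smul, inv_mul_cancel₀ hv, one_smul, mul_assoc]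
    · rw [tF_far h2, tE_self]
      have e : Commute (mk (.F i)) (mk (.F l)) := comm_F i l h2
      exact ((Kinv_comm_of_far h2 (hasWt_F' l)).mul_left e).neg_left
  · rcases trichotomy i l with rfl | h2 | h2
    · rw [tE_adj h1, tF_self, mul_neg, neg_mul]
      congr 1
      rw [mul_assoc, K_qE h1, mul_smul_comm, ← mul_assoc, ← mul_assoc,
        mul_qcomm hv (serre_E i j h1), smul_mul_assoc, smul_smul, mul_inv_cancel₀ hv, one_smul]
    · rw [tE_adj h1, tF_adj h2, mul_smul_comm, smul_mul_assoc]
      congr 1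
      have hl : Commute (mk (.F l)) (qcomm vv (mk (.E j)) (mk (.E i))) :=
        commute_qcomm (E_F_ne i l h2.ne).symm (E_F_ne j l h).symm
      have hEF := E_F_ne j l h
      rw [qcomm.eq_def vv (mk (.F l)), mul_sub, sub_mul, mul_smul_comm, smul_mul_assoc]
      have e1 : mk (.F l) * mk (.F i) * qcomm vv (mk (.E j)) (mk (.E i)) =
          qcomm vv (mk (.E j)) (mk (.E i)) * (mk (.F l) * mk (.F i))
            - vv⁻¹ • (mk (.E j) * mk (.F l) * mk (.K i)) := by
        rw [mul_assoc, F_qE h1, mul_sub, ← mul_assoc, hl.eq, mul_smul_comm, hEF, mul_assoc,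
          mul_assoc]
      have e2 : mk (.F i) * mk (.F l) * qcomm vv (mk (.E j)) (mk (.E i)) =
          qcomm vv (mk (.E j)) (mk (.E i)) * (mk (.F i) * mk (.F l))
            - (mk (.E j) * mk (.F l) * mk (.K i)) := by
        rw [mul_assoc, hl.eq, ← mul_assoc, F_qE h1, sub_mul, smul_mul_assoc, mul_assoc (mk (.E j)),
          K_F_adj h2, mul_smul_comm, smul_smul, inv_mul_cancel₀ hv, one_smul, mul_assoc, mul_assoc]
      rw [e1, e2, smul_sub]
      abel
    · rw [tE_adj h1, tF_far h2]
      exact (commute_qcomm (E_F_ne i l h2.ne).symm (E_F_ne j l h).symm).symm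
  · rcases trichotomy i l with rfl | h2 | h2
    · rw [tE_far h1, tF_self]
      have e : Commute (mk (.E j)) (mk (.E i)) := comm_E j i h1.symm
      exact (e.mul_right (K_comm_of_far h1 (hasWt_E' j)).symm).neg_right
    · rw [tE_far h1, tF_adj h2]
      have e1 : Commute (mk (.E j)) (mk (.F i)) := E_F_ne j i h1.symm.ne
      have e2 : Commute (mk (.E j)) (mk (.F l)) := E_F_ne j l h
      exact (commute_qcomm e1 e2).smul_right _
    · rw [tE_far h1, tF_far h2]; exact E_F_ne j l h

theorem tE_tF_same (i j : Vertex n) :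
    tE i j * tF i j - tF i j * tE i j = (vv - vv⁻¹)⁻¹ • (tK i j - tKinv i j) := by
  have hv := vv_ne_zero
  rcases trichotomy i j with rfl | h | h
  · have hK : tK i i = mk (.Kinv i) := by
      have : Kunit i * Kunit i ^ (-2 : ℤ) = Kunit i ^ (-1 : ℤ) := by group
      rw [tK_eq, cartan_self, this, Kunit_neg_one]
    have hK' : tKinv i i = mk (.K i) := by
      have : (Kunit i * Kunit i ^ (-2 : ℤ))⁻¹ = Kunit i ^ (1 : ℤ) := by group
      rw [tKinv_eq, cartan_self, this, Kunit_one]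
    rw [hK, hK', tE_self, tF_self, neg_mul_neg, neg_mul_neg]
    have hFE : HasWt (mk (.F i) * mk (.E i)) (fun _ => 0) :=
      ((hasWt_F i).mul (hasWt_E i)).congr fun l => by ring
    have h1 : mk (.Kinv i) * mk (.F i) * (mk (.E i) * mk (.K i)) = mk (.F i) * mk (.E i) := by
      have := Kinv_mul hFE i
      rw [neg_zero, zpow_zero, one_smul] at this
      rw [← mul_assoc, mul_assoc (mk (.Kinv i)), this, mul_assoc, Kinv_mul_K, mul_one]
    have h2 : mk (.E i) * mk (.K i) * (mk (.Kinv i) * mk (.F i)) = mk (.E i) * mk (.F i) := by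
      rw [mul_assoc, ← mul_assoc (mk (.K i)), K_mul_Kinv, one_mul]
    rw [h1, h2, ← neg_sub, E_F_same, ← smul_neg, neg_sub]
  · have hK : tK i j = mk (.K j) * mk (.K i) := by
      rw [tK, cartan_adj h, neg_neg, Kunit_one]
    have hK' : tKinv i j = mk (.Kinv i) * mk (.Kinv j) := by
      have : (Kunit j * Kunit i ^ (1 : ℤ))⁻¹ = Kunit i ^ (-1 : ℤ) * Kunit j ^ (-1 : ℤ) := by group
      rw [tKinv_eq, cartan_adj h, neg_neg, this, Units.val_mul, Kunit_neg_one, Kunit_neg_one]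
    have hYY : Commute (mk (.Kinv i)) (mk (.Kinv j)) := by
      have := hasWt_Kinv j
      have := Kinv_mul this i
      rwa [neg_zero, zpow_zero, one_smul] at this
    rw [hK, hK', tE_adj h, tF_adj h]
    obtain ⟨Y, hY⟩ : ∃ Y, Y = qcomm vv (mk (.E j)) (mk (.E i)) := ⟨_, rfl⟩
    have e1 := F_qE h
    have e2 := F_qE' h
    rw [← hY] at e1 e2 ⊢
    have e3 : mk (.F i) * mk (.F j) * Y = Y * (mk (.F i) * mk (.F j))
        - mk (.E j) * mk (.F j) * mk (.K i) + mk (.F i) * mk (.E i) * mk (.Kinv j) := by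
      rw [mul_assoc, e2, mul_add, ← mul_assoc, e1, sub_mul, smul_mul_assoc, mul_assoc (mk (.E j)),
        K_F_adj h, mul_smul_comm, smul_smul, inv_mul_cancel₀ hv, one_smul]
      simp only [mul_assoc]
    have e4 : mk (.F j) * mk (.F i) * Y = Y * (mk (.F j) * mk (.F i))
        + vv⁻¹ • (mk (.E i) * mk (.F i) * mk (.Kinv j))
        - vv⁻¹ • (mk (.F j) * mk (.E j) * mk (.K i)) := by
      rw [mul_assoc, e1, mul_sub, ← mul_assoc, e2, add_mul, mul_smul_comm, mul_assoc (mk (.E i)),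
        Kinv_F_adj h.symm, mul_smul_comm]
      simp only [mul_assoc]
    have e5 := congrArg (fun z => z * mk (.K i)) (E_F_same j)
    have e6 := congrArg (fun z => z * mk (.Kinv j)) (E_F_same i)
    have e7 : mk (.Kinv j) * mk (.K i) = mk (.K i) * mk (.Kinv j) := by
      have := Kinv_mul (hasWt_K i) j
      rwa [neg_zero, zpow_zero, one_smul] at this
    simp only [sub_mul, smul_mul_assoc] at e5 e6
    exact qcomm_bracket hv e3 e4 e5 e6 (e7.trans rfl)
  · have hK : tK i j = mk (.K j) := by simp [tK, cartan_far h]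
    have hK' : tKinv i j = mk (.Kinv j) := by simp [tKinv, cartan_far h]
    rw [hK, hK', tE_far h, tF_far h, E_F_same]

/-- `T_i` on generators. -/
noncomputable def tGen (i : Vertex n) : Gen n → U n
  | .E j => tE i j
  | .F j => tF i j
  | .K j => tK i j
  | .Kinv j => tKinv i j

theorem tGen_rel (i : Vertex n) {x y : Free n} (h : Rel n x y) :
    FreeAlgebra.lift Qv (tGen i) x = FreeAlgebra.lift Qv (tGen i) y := by
  induction h with
  | K_mul_K j l => simpa [tGen] using tK_mul_tK i j l
  | K_mul_Kinv j => simpa [tGen] using tK_mul_tKinv i j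
  | Kinv_mul_K j => simpa [tGen] using tKinv_mul_tK i j
  | K_E j l => simpa [tGen] using tK_tE i j l
  | K_F j l => simpa [tGen] using tK_tF i j l
  | E_F_same j => simpa [tGen] using tE_tF_same i j
  | E_F_ne j l h => simpa [tGen, sub_eq_zero] using tE_tF_ne i j l h
  | serre_E j l h => simpa [tGen] using tE_serre i j l h
  | serre_F j l h => simpa [tGen] using tF_serre i j l h
  | comm_E j l h => simpa [tGen] using tE_comm i j l h
  | comm_F j l h => simpa [tGen] using tF_comm i j l h

/-- Lusztig's homomorphism `T_i` of `U_v(𝔤)` (Lusztig's `T'_{i,-1}`). -/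
noncomputable def braid (i : Vertex n) : U n →ₐ[Qv] U n :=
  RingQuot.liftAlgHom Qv ⟨FreeAlgebra.lift Qv (tGen i), fun _ _ h => tGen_rel i h⟩

theorem braid_mk (i : Vertex n) (g : Gen n) : braid i (mk g) = tGen i g := by
  have : braid i (mk g) = FreeAlgebra.lift Qv (tGen i) (gen g) :=
    RingQuot.liftAlgHom_mkAlgHom_apply Qv _ _ _
  rw [this, FreeAlgebra.lift_ι_apply]

end Braid

section PBW

/-- The generator `E_i` of `U_v(𝔤)` for `1 ≤ i ≤ n` (and `0` for all other `i`). -/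
noncomputable def E (n i : ℕ) : U n := if h : 1 ≤ i ∧ i ≤ n then mk (.E ⟨i, h⟩) else 0

/-- `T_i` for `1 ≤ i ≤ n`, with the convention `T_i = id` for all other `i`. -/
noncomputable def T (n i : ℕ) : U n →ₐ[Qv] U n :=
  if h : 1 ≤ i ∧ i ≤ n then braid ⟨i, h⟩ else AlgHom.id Qv (U n)

/-- The composition `T_{i_1} T_{i_2} ⋯ T_{i_r}` for a list `[i_1, …, i_r]`. -/
noncomputable def Tprod (n : ℕ) (l : List ℕ) : U n →ₐ[Qv] U n :=
  l.foldr (fun i f => (T n i).comp f) (AlgHom.id Qv (U n))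

/-- The list `1, 3, 5, …` of the odd numbers that are at most `m`. -/
def odds (m : ℕ) : List ℕ := (List.range ((m + 1) / 2)).map (fun t => 2 * t + 1)

/-- The list `2, 4, 6, …` of the positive even numbers that are at most `m`. -/
def evens (m : ℕ) : List ℕ := (List.range (m / 2)).map (fun t => 2 * t + 2)

/-- The reduced word `s_1 s_3 ⋯ s_n s_2 s_4 ⋯ s_{n-1} s_1 s_3 ⋯ s_n s_2 s_4 ⋯ s_{n-1}` of `w`
(`n` odd), as the list of its indices `j_1, …, j_{2n}`. -/
def word (n : ℕ) : List ℕ := odds n ++ evens (n - 1) ++ odds n ++ evens (n - 1)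

/-- The root vector `E(β_k) = T_{j_1} ⋯ T_{j_{k-1}}(E_{j_k})`, `1 ≤ k ≤ 2n`, in `U_v(𝔤)`. -/
noncomputable def rootVector (n k : ℕ) : U n :=
  Tprod n ((word n).take (k - 1)) (E n ((word n).getD (k - 1) 0))

/-- The algebra `U_v^+(w)`, generated by the root vectors `E(β_1), …, E(β_{2n})`. -/
noncomputable def UPlus (n : ℕ) : Subalgebra Qv (U n) :=
  Algebra.adjoin Qv {y | ∃ k, (1 ≤ k ∧ k ≤ 2 * n) ∧ y = rootVector n k}

/-- `E(β_k)` as an element of `U_v^+(w)`, for `1 ≤ k ≤ 2n` (and `0` for all other `k`). -/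
noncomputable def Eβ (n k : ℕ) : UPlus n :=
  if h : 1 ≤ k ∧ k ≤ 2 * n then ⟨rootVector n k, Algebra.subset_adjoin ⟨k, h, rfl⟩⟩ else 0

/-- The position `k` such that `u_i = E(β_k)`, for `i` odd. -/
def posU (i : ℕ) : ℕ := (i + 1) / 2

/-- The position `k` such that `v_i = E(β_k)`, for `i` even. -/
def posV (n i : ℕ) : ℕ := (n + 1) / 2 + i / 2

/-- The position `k` such that `w_i = E(β_k)`, for `i` odd. -/
def posW (n i : ℕ) : ℕ := n + (i + 1) / 2

/-- The position `k` such that `x_i = E(β_k)`, for `i` even. -/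
def posX (n i : ℕ) : ℕ := n + (n + 1) / 2 + i / 2

/-- `u_i`, for odd `i` with `1 ≤ i ≤ n`. -/
noncomputable def uGen (n i : ℕ) : UPlus n := Eβ n (posU i)

/-- `v_i`, for even `i` with `2 ≤ i ≤ n - 1`. -/
noncomputable def vGen (n i : ℕ) : UPlus n := Eβ n (posV n i)

/-- `w_i`, for odd `i` with `1 ≤ i ≤ n`. -/
noncomputable def wGen (n i : ℕ) : UPlus n := Eβ n (posW n i)

/-- `x_i`, for even `i` with `2 ≤ i ≤ n - 1`. -/
noncomputable def xGen (n i : ℕ) : UPlus n := Eβ n (posX n i)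

theorem Tprod_append (n : ℕ) (l m : List ℕ) (y : U n) :
    Tprod n (l ++ m) y = Tprod n l (Tprod n m y) := by
  induction l with
  | nil => rfl
  | cons a l ih => exact congrArg (T n a) ih

theorem odds_split (n t : ℕ) (h : 2 * t + 1 ≤ n) :
    ∃ r, odds n = odds (2 * t - 1) ++ (2 * t + 1) :: r := by
  refine ⟨(List.range ((n + 1) / 2 - t - 1)).map (fun s => 2 * (t + 1 + s) + 1), ?_⟩
  have e : (n + 1) / 2 = t + (1 + ((n + 1) / 2 - t - 1)) := by omega
  have e' : (2 * t - 1 + 1) / 2 = t := by omega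
  rw [odds, e, List.range_add, List.range_add, odds, e']
  simp [Function.comp_def, add_assoc]

theorem evens_split (n t : ℕ) (h : 2 * t + 2 ≤ n) :
    ∃ r, evens n = evens (2 * t) ++ (2 * t + 2) :: r := by
  refine ⟨(List.range (n / 2 - t - 1)).map (fun s => 2 * (t + 1 + s) + 2), ?_⟩
  have e : n / 2 = t + (1 + (n / 2 - t - 1)) := by omega
  have e' : (2 * t) / 2 = t := by omega
  rw [evens, e, List.range_add, List.range_add, evens, e']
  simp [Function.comp_def, add_assoc]

theorem rootVector_eq {n k i : ℕ} {l r : List ℕ} (h : word n = l ++ i :: r)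
    (hk : k = l.length + 1) : rootVector n k = Tprod n l (E n i) := by
  subst hk
  simp [rootVector, h]

theorem Eβ_eq {n k : ℕ} (h : 1 ≤ k ∧ k ≤ 2 * n) : (Eβ n k : U n) = rootVector n k := by
  simp only [Eβ, h, and_self, dif_pos]

/-- `u_i = T_1 T_3 ⋯ T_{i-2}(E_i)`. -/
theorem uGen_eq {n i : ℕ} (hi : Odd i) (h : i ≤ n) :
    (uGen n i : U n) = Tprod n (odds (i - 2)) (E n i) := by
  obtain ⟨t, rfl⟩ := hi
  obtain ⟨r, hr⟩ := odds_split n t h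
  rw [uGen, Eβ_eq (by unfold posU; omega)]
  refine rootVector_eq (r := r ++ evens (n - 1) ++ odds n ++ evens (n - 1)) ?_ ?_
  · rw [word, hr]; simp
  · simp [posU, odds]; omega

/-- `v_i = T_1 T_3 ⋯ T_n T_2 T_4 ⋯ T_{i-2}(E_i)`. -/
theorem vGen_eq {n i : ℕ} (hn : Odd n) (hi : Even i) (h : 2 ≤ i) (h' : i ≤ n - 1) :
    (vGen n i : U n) = Tprod n (odds n ++ evens (i - 2)) (E n i) := by
  obtain ⟨m, rfl⟩ := hn
  obtain ⟨t, rfl⟩ : ∃ t, i = 2 * t + 2 := by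
    obtain ⟨s, rfl⟩ := hi; exact ⟨s - 1, by omega⟩
  obtain ⟨r, hr⟩ := evens_split (2 * m + 1 - 1) t h'
  rw [vGen, Eβ_eq (by unfold posV; omega)]
  refine rootVector_eq (r := r ++ odds (2 * m + 1) ++ evens (2 * m + 1 - 1)) ?_ ?_
  · rw [word, hr]; simp
  · simp [posV, odds, evens]; omega

/-- `w_i = T T_1 T_3 ⋯ T_{i-2}(E_i)` with `T = T_1 T_3 ⋯ T_n T_2 T_4 ⋯ T_{n-1}`. -/
theorem wGen_eq {n i : ℕ} (hn : Odd n) (hi : Odd i) (h : i ≤ n) :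
    (wGen n i : U n) = Tprod n (odds n ++ evens (n - 1)) (Tprod n (odds (i - 2)) (E n i)) := by
  obtain ⟨m, rfl⟩ := hn
  obtain ⟨t, rfl⟩ := hi
  obtain ⟨r, hr⟩ := odds_split (2 * m + 1) t h
  rw [wGen, Eβ_eq (by unfold posW; omega), ← Tprod_append]
  refine rootVector_eq (r := r ++ evens (2 * m + 1 - 1)) ?_ ?_
  · conv_lhs => rw [word, List.append_assoc, hr]
    rw [hr]; simp
  · simp [posW, odds, evens]; omega

/-- `x_i = T T_1 T_3 ⋯ T_n T_2 T_4 ⋯ T_{i-2}(E_i)` with `T = T_1 T_3 ⋯ T_n T_2 T_4 ⋯ T_{n-1}`. -/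
theorem xGen_eq {n i : ℕ} (hn : Odd n) (hi : Even i) (h : 2 ≤ i) (h' : i ≤ n - 1) :
    (xGen n i : U n) =
      Tprod n (odds n ++ evens (n - 1)) (Tprod n (odds n ++ evens (i - 2)) (E n i)) := by
  obtain ⟨m, rfl⟩ := hn
  obtain ⟨t, rfl⟩ : ∃ t, i = 2 * t + 2 := by
    obtain ⟨s, rfl⟩ := hi; exact ⟨s - 1, by omega⟩
  obtain ⟨r, hr⟩ := evens_split (2 * m + 1 - 1) t h'
  rw [xGen, Eβ_eq (by unfold posX; omega), ← Tprod_append]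
  refine rootVector_eq (r := r) ?_ ?_
  · rw [word, hr]; simp
  · simp [posX, odds, evens]; omega

/-- `Listed n j i` says that `E(β_j) E(β_i)` is the left-hand side of one of the explicit
straightening relations. -/
inductive Listed (n : ℕ) : ℕ → ℕ → Prop
  | vu_succ (i : ℕ) (hi : Odd i) (h : 1 ≤ i ∧ i ≤ n - 2) : Listed n (posV n (i + 1)) (posU i)
  | vu_pred (i : ℕ) (hi : Odd i) (h : 3 ≤ i ∧ i ≤ n) : Listed n (posV n (i - 1)) (posU i)
  | wu_succ (i : ℕ) (hi : Odd i) (h : 1 ≤ i ∧ i ≤ n - 2) : Listed n (posW n (i + 2)) (posU i)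
  | wu_pred (i : ℕ) (hi : Odd i) (h : 3 ≤ i ∧ i ≤ n) : Listed n (posW n (i - 2)) (posU i)
  | wu_first : Listed n (posW n 1) (posU 1)
  | wu_mid (i : ℕ) (hi : Odd i) (h : 3 ≤ i ∧ i ≤ n - 2) : Listed n (posW n i) (posU i)
  | wu_last : Listed n (posW n n) (posU n)
  | xu_succ_three (i : ℕ) (hi : Odd i) (h : 1 ≤ i ∧ i ≤ n - 4) :
      Listed n (posX n (i + 3)) (posU i)
  | xu_pred_three (i : ℕ) (hi : Odd i) (h : 5 ≤ i ∧ i ≤ n) : Listed n (posX n (i - 3)) (posU i)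
  | xu_pred (i : ℕ) (hi : Odd i) (h : 3 ≤ i ∧ i ≤ n - 2) : Listed n (posX n (i - 1)) (posU i)
  | xu_last : Listed n (posX n (n - 1)) (posU n)
  | xu_first : Listed n (posX n 2) (posU 1)
  | xu_succ (i : ℕ) (hi : Odd i) (h : 3 ≤ i ∧ i ≤ n - 2) : Listed n (posX n (i + 1)) (posU i)
  | wv_succ (i : ℕ) (hi : Even i) (h : 2 ≤ i ∧ i ≤ n - 1) : Listed n (posW n (i + 1)) (posV n i)
  | wv_pred (i : ℕ) (hi : Even i) (h : 2 ≤ i ∧ i ≤ n - 1) : Listed n (posW n (i - 1)) (posV n i)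
  | xv_succ (i : ℕ) (hi : Even i) (h : 2 ≤ i ∧ i ≤ n - 3) : Listed n (posX n (i + 2)) (posV n i)
  | xv_pred (i : ℕ) (hi : Even i) (h : 4 ≤ i ∧ i ≤ n - 1) : Listed n (posX n (i - 2)) (posV n i)
  | xv_same (i : ℕ) (hi : Even i) (h : 2 ≤ i ∧ i ≤ n - 1) : Listed n (posX n i) (posV n i)
  | xw_succ (i : ℕ) (hi : Odd i) (h : 1 ≤ i ∧ i ≤ n - 2) : Listed n (posX n (i + 1)) (posW n i)
  | xw_pred (i : ℕ) (hi : Odd i) (h : 3 ≤ i ∧ i ≤ n) : Listed n (posX n (i - 1)) (posW n i)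

end PBW

end QuantumGroup

open QuantumGroup

/-! Let `Todd` and `Teven` be the products of the `T_i` over odd and over even `i`. Since `T_i`
fixes `E_j` when `|i - j| ≥ 2`, the root vectors are u_i = E_i, v_i = Todd(E_i), w_i = Todd
Teven(E_i), x_i = Todd Teven Todd(E_i). These maps are algebra homomorphisms, so a relation between
two root vectors may be proved before a common outer factor is applied. When the earlier vector has
too few factors, they are created from T_i(-F_i K_i) = E_i: thus u_i = Todd(`negFK` i) and v_i =
Todd Teven(`negFK` i).

What remains is local. On a vertex j with neighbours l, r, the opposite-parity product sends E_j to
T_l T_r(E_j) (`spread`), which inside the diagram is the iterated v-commutator [[E_j, E_l], E_r]. By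
the Serre relation it v-commutes with E_r. Against -F_j K_j, the inner commutator [E_j, E_l]
contributes a factor v⁻¹ and a correction E_l, while E_r contributes a factor v. The factors cancel
and the correction becomes (v - v⁻¹) E_l E_r (`spread_mul_negFK_mid`). At an end of the diagram the
outer commutator is absent, so v⁻¹ and the bare correction E_l survive (`spread_mul_negFK_end`).

For the pairs x, u one also needs Teven(T_l T_r(E_j)). It equals [T_k(E_l), T_j T_s(E_r)] for
consecutive k, l, j, r, s (`wide`, `Teven_spread`). As T_k(E_l) commutes with -F_r K_r, bracketing
with it carries the previous relations over and turns the correction E_j E_s into T_k T_j(E_l) E_s,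
which `Todd` maps to w_l v_s.

All other pairs commute because only vertices at distance at least two meet. With T_i = id outside
1, …, n, the two ends of the diagram need few separate arguments. -/

namespace QuantumGroup


/-! ### Moving an element past a q-commutator -/

section Skew

variable {k A : Type*} [Field k] [Ring A] [Algebra k A] {q : k}

theorem qcomm_mul_of_skew {Y X Z : A} {s t : k} (hY : Y * Z = s • (Z * Y))
    (hX : X * Z = t • (Z * X)) : qcomm q Y X * Z = (s * t) • (Z * qcomm q Y X) := by
  have hY' (a : A) : Y * (Z * a) = s • (Z * (Y * a)) := by
    rw [← mul_assoc, hY, smul_mul_assoc, mul_assoc]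
  have hX' (a : A) : X * (Z * a) = t • (Z * (X * a)) := by
    rw [← mul_assoc, hX, smul_mul_assoc, mul_assoc]
  simp only [qcomm, sub_mul, mul_sub, smul_mul_assoc, mul_smul_comm, mul_assoc, hX, hY, hX', hY']
  module

/-- This is the source of every coefficient v - v⁻¹. The factors q⁻¹ and q cancel on the main term,
whereas `L` appears with q from the product Y X and with -q⁻¹ from the product X Y. -/
theorem qcomm_mul_of_skew_add (hq : q ≠ 0) {Y X Z L : A} (hY : Y * Z = q⁻¹ • (Z * Y) + L)
    (hX : X * Z = q • (Z * X)) (hL : L * X = X * L) :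
    qcomm q Y X * Z = Z * qcomm q Y X + (q - q⁻¹) • (L * X) := by
  have hY' (a : A) : Y * (Z * a) = q⁻¹ • (Z * (Y * a)) + L * a := by
    rw [← mul_assoc, hY, add_mul, smul_mul_assoc, mul_assoc]
  have hX' (a : A) : X * (Z * a) = q • (Z * (X * a)) := by
    rw [← mul_assoc, hX, smul_mul_assoc, mul_assoc]
  simp only [qcomm, sub_mul, mul_sub, smul_mul_assoc, mul_smul_comm, mul_assoc, hX, hY, hX', hY',
    hL, mul_add]
  match_scalars <;> field_simp

/-- Bracketing with `G` commutes with left and right multiplication by `Z`, so it can be applied to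
the relation for `P` term by term. -/
theorem qcomm_mul_of_comm {G P Z D : A} {c : k} (hG : G * Z = Z * G)
    (hP : P * Z = c • (Z * P) + D) :
    qcomm q G P * Z = c • (Z * qcomm q G P) + qcomm q G D := by
  have hG' (a : A) : G * (Z * a) = Z * (G * a) := by rw [← mul_assoc, hG, mul_assoc]
  have hP' (a : A) : P * (Z * a) = c • (Z * (P * a)) + D * a := by
    rw [← mul_assoc, hP, add_mul, smul_mul_assoc, mul_assoc]
  simp only [qcomm, sub_mul, mul_sub, smul_mul_assoc, mul_smul_comm, mul_assoc, hG, hP, hG', hP',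
    mul_add]
  module

theorem qcomm_smul_mul {G X Y : A} {c : k} (h : G * Y = Y * G) :
    qcomm q G (c • (X * Y)) = c • (qcomm q G X * Y) := by
  simp only [qcomm, sub_mul, smul_mul_assoc, mul_smul_comm, mul_assoc, h]
  module

/-- The expansion XYZ - q⁻¹ YXZ - q⁻¹ ZXY + q⁻² ZYX is symmetric in two commuting elements Y and Z.
-/
theorem qcomm_comm {X Y Z : A} (h : Y * Z = Z * Y) :
    qcomm q (qcomm q X Y) Z = qcomm q (qcomm q X Z) Y := by
  have h' (a : A) : Y * (Z * a) = Z * (Y * a) := by rw [← mul_assoc, h, mul_assoc]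
  simp only [qcomm, sub_mul, mul_sub, smul_mul_assoc, mul_smul_comm, mul_assoc, h, h']
  module

theorem map_qcomm {B : Type*} [Ring B] [Algebra k B] (f : A →ₐ[k] B) (b a : A) :
    f (qcomm q b a) = qcomm q (f b) (f a) := by
  simp [qcomm]

end Skew

/-! ### Computations around one vertex and its neighbours -/

section Local

variable {n : ℕ}

theorem E_of_mem {i : ℕ} (h : 1 ≤ i ∧ i ≤ n) : E n i = mk (.E ⟨i, h⟩) := dif_pos h

theorem T_of_mem {i : ℕ} (h : 1 ≤ i ∧ i ≤ n) : T n i = braid ⟨i, h⟩ := dif_pos h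

theorem T_of_not_mem {i : ℕ} (h : ¬ (1 ≤ i ∧ i ≤ n)) (y : U n) : T n i y = y := by
  rw [T, dif_neg h]; rfl

/-- The element `-F_i K_i`, which `T_i` maps to `E_i`, for `1 ≤ i ≤ n` (and `0` otherwise). -/
noncomputable def negFK (n i : ℕ) : U n :=
  if h : 1 ≤ i ∧ i ≤ n then -(mk (.F ⟨i, h⟩) * mk (.K ⟨i, h⟩)) else 0

theorem negFK_of_mem {i : ℕ} (h : 1 ≤ i ∧ i ≤ n) :
    negFK n i = -(mk (.F ⟨i, h⟩) * mk (.K ⟨i, h⟩)) := dif_pos h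

/-- `i` and `j` differ by one. -/
def Next (i j : ℕ) : Prop := i + 1 = j ∨ j + 1 = i

/-- `i` and `j` differ by at least two. -/
def Apart (i j : ℕ) : Prop := i + 2 ≤ j ∨ j + 2 ≤ i

theorem T_E_apart {i j : ℕ} (h : Apart i j) : T n i (E n j) = E n j := by
  by_cases hi : 1 ≤ i ∧ i ≤ n
  · by_cases hj : 1 ≤ j ∧ j ≤ n
    · rw [T_of_mem hi, E_of_mem hj, braid_mk]
      exact tE_far h
    · rw [E, dif_neg hj, map_zero]
  · exact T_of_not_mem hi _

theorem T_negFK_apart {i j : ℕ} (h : Apart i j) : T n i (negFK n j) = negFK n j := by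
  by_cases hi : 1 ≤ i ∧ i ≤ n
  · by_cases hj : 1 ≤ j ∧ j ≤ n
    · have hf : Far (⟨i, hi⟩ : Vertex n) ⟨j, hj⟩ := h
      rw [T_of_mem hi, negFK_of_mem hj, map_neg, map_mul, braid_mk, braid_mk]
      simp [tGen, tF_far hf, tK, cartan_far hf]
    · rw [negFK, dif_neg hj, map_zero]
  · exact T_of_not_mem hi _

/-- T_i(-F_i K_i) = E_i K_i K_i⁻¹. This preimage of E_i lets a bare generator be pulled under the
same `T_i` as the factor multiplying it. -/
theorem T_negFK_self (i : ℕ) : T n i (negFK n i) = E n i := by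
  by_cases hi : 1 ≤ i ∧ i ≤ n
  · rw [T_of_mem hi, negFK_of_mem hi, E_of_mem hi, map_neg, map_mul, braid_mk, braid_mk]
    have hK : tK (⟨i, hi⟩ : Vertex n) ⟨i, hi⟩ = mk (.Kinv ⟨i, hi⟩) := by
      have : Kunit (⟨i, hi⟩ : Vertex n) * Kunit ⟨i, hi⟩ ^ (-2 : ℤ)
          = Kunit ⟨i, hi⟩ ^ (-1 : ℤ) := by group
      rw [tK_eq, cartan_self, this, Kunit_neg_one]
    simp only [tGen, hK, tF_self, neg_mul, neg_neg]
    rw [mul_assoc, K_mul_Kinv, mul_one]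
  · rw [negFK, E, dif_neg hi, dif_neg hi, map_zero]

theorem T_T_E_self_apart {i j : ℕ} (h : Apart i j) :
    T n i (T n j (E n j)) = T n j (E n j) := by
  by_cases hi : 1 ≤ i ∧ i ≤ n
  · by_cases hj : 1 ≤ j ∧ j ≤ n
    · have hf : Far (⟨i, hi⟩ : Vertex n) ⟨j, hj⟩ := h
      rw [T_of_mem hi, T_of_mem hj, E_of_mem hj, braid_mk]
      simp [tGen, tE_self, braid_mk, tF_far hf, tKinv, cartan_far hf]
    · rw [E, dif_neg hj, map_zero, map_zero]
  · exact T_of_not_mem hi _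

theorem T_E_next {i j : ℕ} (h : Next i j) (hi : 1 ≤ i ∧ i ≤ n) (hj : 1 ≤ j ∧ j ≤ n) :
    T n i (E n j) = qcomm vv (E n j) (E n i) := by
  rw [T_of_mem hi, E_of_mem hj, E_of_mem hi, braid_mk]
  exact tE_adj h

/-- Bracketing with T_i(E_i) = -K_i⁻¹ F_i undoes the bracket with E_i inside T_i(E_j). This is the
cancellation that keeps the vectors x_j short. -/
theorem qcomm_T_E {i j : ℕ} (h : Next i j) (hi : 1 ≤ i ∧ i ≤ n) (hj : 1 ≤ j ∧ j ≤ n) :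
    qcomm vv (T n i (E n i)) (T n i (E n j)) = E n j := by
  rw [T_of_mem hi, E_of_mem hj, E_of_mem hi, braid_mk, braid_mk]
  have := tE_self_mul (n := n) (i := ⟨i, hi⟩) (j := ⟨j, hj⟩) h
  simp only [tGen]
  rw [qcomm, this, one_smul, add_sub_cancel_left]

theorem E_comm_apart {i j : ℕ} (h : Apart i j) : E n i * E n j = E n j * E n i := by
  by_cases hi : 1 ≤ i ∧ i ≤ n
  · by_cases hj : 1 ≤ j ∧ j ≤ n
    · rw [E_of_mem hi, E_of_mem hj]
      exact comm_E _ _ h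
    · simp [E, dif_neg hj]
  · simp [E, dif_neg hi]

theorem E_negFK_apart {i j : ℕ} (h : Apart i j) : E n i * negFK n j = negFK n j * E n i := by
  by_cases hi : 1 ≤ i ∧ i ≤ n
  · by_cases hj : 1 ≤ j ∧ j ≤ n
    · have hf : Far (⟨j, hj⟩ : Vertex n) ⟨i, hi⟩ := Or.symm h
      have e : Commute (mk (.E (⟨i, hi⟩ : Vertex n))) (mk (.F ⟨j, hj⟩)) := E_F_ne _ _ hf.symm.ne
      rw [E_of_mem hi, negFK_of_mem hj]
      exact (e.mul_right (K_comm_of_far hf (hasWt_E' _)).symm).neg_right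
    · simp [negFK, dif_neg hj]
  · simp [E, dif_neg hi]

theorem E_negFK_next {i j : ℕ} (h : Next i j) : E n i * negFK n j = vv • (negFK n j * E n i) := by
  by_cases hi : 1 ≤ i ∧ i ≤ n
  · by_cases hj : 1 ≤ j ∧ j ≤ n
    · have hf : Adj (⟨j, hj⟩ : Vertex n) ⟨i, hi⟩ := Or.symm h
      rw [E_of_mem hi, negFK_of_mem hj, mul_neg, ← mul_assoc, E_F_ne _ _ hf.symm.ne, neg_mul,
        mul_assoc, mul_assoc, K_E_adj hf, mul_smul_comm, smul_neg, smul_smul,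
        mul_inv_cancel₀ vv_ne_zero, one_smul]
    · simp [negFK, dif_neg hj]
  · simp [E, dif_neg hi]

/-- The quantum Serre relation, rewritten for the commutator. -/
theorem qcomm_E_mul_E {i j : ℕ} (h : Next i j) (hi : 1 ≤ i ∧ i ≤ n) (hj : 1 ≤ j ∧ j ≤ n) :
    qcomm vv (E n j) (E n i) * E n i = vv • (E n i * qcomm vv (E n j) (E n i)) := by
  have ha : Adj (⟨i, hi⟩ : Vertex n) ⟨j, hj⟩ := h
  rw [E_of_mem hi, E_of_mem hj, mul_qcomm vv_ne_zero (serre_E _ _ ha), smul_smul,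
    mul_inv_cancel₀ vv_ne_zero, one_smul]

/-- Moving F_j past the commutator leaves a term E_i K_j⁻¹, and the K_j in -F_j K_j is there to
cancel this K_j⁻¹. All correction terms originate here. -/
theorem qcomm_E_mul_negFK {i j : ℕ} (h : Next i j) (hi : 1 ≤ i ∧ i ≤ n) (hj : 1 ≤ j ∧ j ≤ n) :
    qcomm vv (E n j) (E n i) * negFK n j
      = vv⁻¹ • (negFK n j * qcomm vv (E n j) (E n i)) + E n i := by
  have ha : Adj (⟨i, hi⟩ : Vertex n) ⟨j, hj⟩ := h
  rw [E_of_mem hi, E_of_mem hj, negFK_of_mem hj]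
  have e1 := F_qE' ha
  -- The weight of T_i(E_j) at `j` is 2 - (-1)(-1) = 1, whence the factor v⁻¹ when K_j is moved to
  -- the left.
  have e2 := hasWt_tE (⟨i, hi⟩ : Vertex n) ⟨j, hj⟩ ⟨j, hj⟩
  simp only [tE_adj ha, cartan_self, cartan_adj ha, cartan_adj ha.symm] at e2
  norm_num at e2
  rw [mul_neg, ← mul_assoc, eq_sub_of_add_eq e1.symm, neg_mul, sub_mul, mul_assoc, mul_assoc,
    mul_assoc (mk (.F _)) (mk (.K _)), e2, Kinv_mul_K, mul_one, mul_smul_comm, smul_neg, smul_smul,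
    inv_mul_cancel₀ vv_ne_zero, one_smul, neg_sub, sub_eq_neg_add]

/-- `l`, `j`, `r` are consecutive, in increasing or in decreasing order. -/
def Between (l j r : ℕ) : Prop := (l + 1 = j ∧ j + 1 = r) ∨ (r + 1 = j ∧ j + 1 = l)

/-- The element `T_l T_r (E_j)`, for `l` and `r` the two neighbours of `j`. -/
noncomputable def spread (n l j r : ℕ) : U n := T n l (T n r (E n j))

/-- Both neighbours must exist: outside the diagram `T` is the identity but `E` is 0, so the closed
form would vanish while T_l T_r(E_j) does not lose its inner part. -/
theorem spread_mid {l j r : ℕ} (h : Between l j r) (hl : 1 ≤ l ∧ l ≤ n) (hr : 1 ≤ r ∧ r ≤ n) :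
    spread n l j r = qcomm vv (qcomm vv (E n j) (E n l)) (E n r) := by
  unfold Between at h
  rw [spread, T_E_next (by unfold Next; omega) hr (by omega), map_qcomm,
    T_E_next (by unfold Next; omega) hl (by omega), T_E_apart (by unfold Apart; omega)]

/-- Only this instance of the commutation of T_l with T_r is needed, and it follows from the
symmetry of the iterated commutator; the braid relations are not used. -/
theorem spread_symm {l j r : ℕ} (h : Between l j r) :
    spread n l j r = spread n r j l := by
  by_cases hl : 1 ≤ l ∧ l ≤ n
  · by_cases hr : 1 ≤ r ∧ r ≤ n
    · rw [spread_mid h hl hr, spread_mid (Or.symm h) hr hl]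
      exact qcomm_comm (E_comm_apart (by unfold Apart; unfold Between at h; omega))
    · rw [spread, spread, T_of_not_mem hr, T_of_not_mem hr]
  · rw [spread, spread, T_of_not_mem hl, T_of_not_mem hl]

theorem T_spread {l j r k : ℕ} (h : Between l j r) (hj : 1 ≤ j ∧ j ≤ n) (h1 : Apart k l)
    (h2 : Apart k j) (h3 : Apart k r) : T n k (spread n l j r) = spread n l j r := by
  have hb := h
  unfold Between at hb
  have key {m : ℕ} (hm : Next m j) (hk : Apart k m) : T n k (T n m (E n j)) = T n m (E n j) := by
    by_cases hv : 1 ≤ m ∧ m ≤ n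
    · rw [T_E_next hm hv hj, map_qcomm, T_E_apart hk, T_E_apart h2]
    · rw [T_of_not_mem hv, T_E_apart h2]
  by_cases hl : 1 ≤ l ∧ l ≤ n
  · by_cases hr : 1 ≤ r ∧ r ≤ n
    · rw [spread_mid h hl hr, map_qcomm, map_qcomm, T_E_apart h1, T_E_apart h2, T_E_apart h3]
    · rw [spread, T_of_not_mem hr, key (by unfold Next; omega) h1]
  · rw [spread, T_of_not_mem hl, key (by unfold Next; omega) h3]

/-- T_l is applied to the Serre relation between T_r(E_j) and E_r. It fixes E_r, and `l` may lie
outside the diagram. -/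
theorem spread_mul_E {l j r : ℕ} (h : Between l j r) (hj : 1 ≤ j ∧ j ≤ n) (hr : 1 ≤ r ∧ r ≤ n) :
    spread n l j r * E n r = vv • (E n r * spread n l j r) := by
  unfold Between at h
  have e := congrArg (T n l) (qcomm_E_mul_E (i := r) (by unfold Next; omega) hr hj)
  rwa [← T_E_next (by unfold Next; omega) hr hj, map_smul, map_mul, map_mul,
    T_E_apart (i := l) (j := r) (by unfold Apart; omega)] at e

theorem spread_comm {l j r : ℕ} {Z : U n} (h1 : T n l Z = Z) (h2 : T n r Z = Z)
    (h3 : E n j * Z = Z * E n j) : spread n l j r * Z = Z * spread n l j r := by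
  have e := congrArg (fun y => T n l (T n r y)) h3
  simpa only [spread, map_mul, h1, h2] using e

theorem spread_mul_negFK {l j r s : ℕ} (h : Between l j r) (h' : Between j r s)
    (hj : 1 ≤ j ∧ j ≤ n) (hr : 1 ≤ r ∧ r ≤ n) :
    spread n l j r * negFK n s = vv • (negFK n s * spread n l j r) := by
  unfold Between at h h'
  have e0 : E n j * negFK n s = (1 : Qv) • (negFK n s * E n j) := by
    rw [one_smul]; exact E_negFK_apart (by unfold Apart; omega)
  have e := congrArg (T n l)
    (qcomm_mul_of_skew (q := vv) e0 (E_negFK_next (i := r) (j := s) (by unfold Next; omega)))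
  rwa [← T_E_next (by unfold Next; omega) hr hj, map_smul, map_mul, map_mul, one_mul,
    T_negFK_apart (by unfold Apart; omega)] at e

/-- `qcomm_mul_of_skew_add` with Y = [E_j, E_l], X = E_r, Z = -F_j K_j and L = E_l. -/
theorem spread_mul_negFK_mid {l j r : ℕ} (h : Between l j r) (hl : 1 ≤ l ∧ l ≤ n)
    (hr : 1 ≤ r ∧ r ≤ n) :
    spread n l j r * negFK n j
      = negFK n j * spread n l j r + (vv - vv⁻¹) • (E n l * E n r) := by
  rw [spread_mid h hl hr]
  unfold Between at h
  exact qcomm_mul_of_skew_add vv_ne_zero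
    (qcomm_E_mul_negFK (by unfold Next; omega) hl (by omega))
    (E_negFK_next (by unfold Next; omega)) (E_comm_apart (by unfold Apart; omega))

/-- With `r` off the diagram only the inner commutator is left, so nothing compensates its factor
v⁻¹. -/
theorem spread_mul_negFK_end {l j r : ℕ} (h : Between l j r) (hl : 1 ≤ l ∧ l ≤ n)
    (hj : 1 ≤ j ∧ j ≤ n) (hr : ¬ (1 ≤ r ∧ r ≤ n)) :
    spread n l j r * negFK n j = vv⁻¹ • (negFK n j * spread n l j r) + E n l := by
  unfold Between at h
  rw [spread, T_of_not_mem hr, T_E_next (by unfold Next; omega) hl hj]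
  exact qcomm_E_mul_negFK (by unfold Next; omega) hl hj

/-- The `q`-commutator of `T_k(E_l)` and `T_j T_s (E_r)` for consecutive `k, l, j, r, s`. -/
noncomputable def wide (n k l j r s : ℕ) : U n := qcomm vv (T n k (E n l)) (spread n j r s)

/-! ### Computations on five consecutive vertices -/

section Wide

variable {k l j r s : ℕ}

theorem T_E_mul {Z : U n} (h : T n k Z = Z) (h' : E n l * Z = Z * E n l) :
    T n k (E n l) * Z = Z * T n k (E n l) := by
  simpa only [map_mul, h] using congrArg (T n k) h'

theorem qcomm_T_E_eq_spread (h : Between k l j)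
    (hl : 1 ≤ l ∧ l ≤ n) (hj : 1 ≤ j ∧ j ≤ n) : qcomm vv (T n k (E n l)) (E n j) = spread n k l j := by
  unfold Between at *
  rw [spread, T_E_next (i := j) (by unfold Next; omega) hj hl, map_qcomm,
    T_E_apart (i := k) (j := j) (by unfold Apart; omega)]

/-- T_k(E_l) commutes with -F_r K_r and with E_s, since k and l are far from r and s. Bracketing the
relation for T_j T_s(E_r) with it therefore only changes the correction, from E_j E_s to [T_k(E_l),
E_j] E_s. -/
theorem wide_mul_negFK_mid (h1 : Between k l j) (h2 : Between l j r) (h3 : Between j r s)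
    (hl : 1 ≤ l ∧ l ≤ n) (hj : 1 ≤ j ∧ j ≤ n) (hs : 1 ≤ s ∧ s ≤ n) :
    wide n k l j r s * negFK n r
      = negFK n r * wide n k l j r s + (vv - vv⁻¹) • (spread n k l j * E n s) := by
  have e := spread_mul_negFK_mid h3 hj hs
  rw [← one_smul Qv (negFK n r * _)] at e
  have b := qcomm_T_E_eq_spread h1 hl hj
  unfold Between at *
  rw [wide, qcomm_mul_of_comm (T_E_mul (T_negFK_apart (by unfold Apart; omega))
    (E_negFK_apart (by unfold Apart; omega))) e, qcomm_smul_mul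
    (T_E_mul (T_E_apart (by unfold Apart; omega)) (E_comm_apart (by unfold Apart; omega))), b,
    one_smul]

theorem wide_mul_negFK_end (h1 : Between k l j) (h2 : Between l j r) (h3 : Between j r s)
    (hl : 1 ≤ l ∧ l ≤ n) (hj : 1 ≤ j ∧ j ≤ n) (hr : 1 ≤ r ∧ r ≤ n)
    (hs : ¬ (1 ≤ s ∧ s ≤ n)) :
    wide n k l j r s * negFK n r = vv⁻¹ • (negFK n r * wide n k l j r s) + spread n k l j := by
  have e := spread_mul_negFK_end h3 hj hr hs
  have b := qcomm_T_E_eq_spread h1 hl hj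
  unfold Between at *
  rw [wide, qcomm_mul_of_comm (T_E_mul (T_negFK_apart (by unfold Apart; omega))
    (E_negFK_apart (by unfold Apart; omega))) e, b]

theorem wide_mul_negFK_skew {t : ℕ} (h1 : Between k l j) (h2 : Between l j r) (h3 : Between j r s)
    (hr : 1 ≤ r ∧ r ≤ n) (h4 : Between r s t) (hs : 1 ≤ s ∧ s ≤ n) :
    wide n k l j r s * negFK n t = vv • (negFK n t * wide n k l j r s) := by
  have e := spread_mul_negFK h3 h4 hr hs
  have e0 : T n k (E n l) * negFK n t = (1 : Qv) • (negFK n t * T n k (E n l)) := by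
    unfold Between at *
    rw [one_smul]
    exact T_E_mul (T_negFK_apart (by unfold Apart; omega)) (E_negFK_apart (by unfold Apart; omega))
  rw [wide, qcomm_mul_of_skew e0 e, one_mul]

theorem wide_mul_negFK_comm {t : ℕ} (hk : Apart k t) (hl : Apart l t) (hj : Apart j t)
    (hr : Apart r t) (hs : Apart s t) :
    wide n k l j r s * negFK n t = negFK n t * wide n k l j r s := by
  have e := spread_comm (T_negFK_apart hj) (T_negFK_apart hs) (E_negFK_apart (n := n) hr)
  have e0 := T_E_mul (T_negFK_apart hk) (E_negFK_apart (n := n) hl)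
  rw [← one_smul Qv (negFK n t * _)] at e e0
  rw [wide, qcomm_mul_of_skew e0 e, one_mul, one_smul]

end Wide

end Local


/-! ### The products of the `T_i` over odd and over even indices -/

section Strides

variable {n : ℕ}

/-- The list `c, c + 2, c + 4, …` of length `N`. -/
def stride (c N : ℕ) : List ℕ := (List.range N).map (fun t => c + 2 * t)

theorem stride_add (c M N : ℕ) : stride c (M + N) = stride c M ++ stride (c + 2 * M) N := by
  simp [stride, List.range_add, Function.comp_def, mul_add, add_assoc]

theorem mem_stride {c N i : ℕ} : i ∈ stride c N ↔ ∃ t < N, c + 2 * t = i := by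
  simp [stride]

theorem Tprod_cons (i : ℕ) (l : List ℕ) (y : U n) : Tprod n (i :: l) y = T n i (Tprod n l y) := rfl

theorem Tprod_fixed {l : List ℕ} {y : U n} (h : ∀ i ∈ l, T n i y = y) : Tprod n l y = y := by
  induction l with
  | nil => rfl
  | cons a l ih =>
    rw [Tprod_cons, ih fun i hi => h i (List.mem_cons_of_mem _ hi), h a List.mem_cons_self]

/-- The rightmost factors act first. Those of index above c + 2t fix `y`, the factor at c + 2t turns
`y` into `z`, and the remaining ones fix `z`. -/
theorem Tprod_stride_of_mem {c t N : ℕ} (ht : t < N) {y z : U n}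
    (hy : ∀ i, c + 2 * t + 2 ≤ i → T n i y = y) (hz : ∀ i, i + 2 ≤ c + 2 * t → T n i z = z)
    (h : T n (c + 2 * t) y = z) : Tprod n (stride c N) y = z := by
  obtain ⟨M, rfl⟩ : ∃ M, N = t + (1 + M) := ⟨N - t - 1, by omega⟩
  rw [stride_add, stride_add, Tprod_append, Tprod_append, Tprod_fixed fun i hi => hy i ?_]
  · change Tprod n _ (T n (c + 2 * t) y) = z
    rw [h]
    refine Tprod_fixed fun i hi => hz i ?_
    obtain ⟨s, hs, rfl⟩ := mem_stride.1 hi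
    omega
  · obtain ⟨s, hs, rfl⟩ := mem_stride.1 hi
    omega

theorem Tprod_stride_negFK {c t N j : ℕ} (ht : t < N) (hj : j = c + 2 * t) :
    Tprod n (stride c N) (negFK n j) = E n j := by
  subst hj
  exact Tprod_stride_of_mem ht (fun i hi => T_negFK_apart (by unfold Apart; omega))
    (fun i hi => T_E_apart (by unfold Apart; omega)) (T_negFK_self _)

theorem Tprod_stride_E {c t N j : ℕ} (ht : t < N) (hj : j = c + 2 * t) :
    Tprod n (stride c N) (E n j) = T n j (E n j) := by
  subst hj
  exact Tprod_stride_of_mem ht (fun i hi => T_E_apart (by unfold Apart; omega))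
    (fun i hi => T_T_E_self_apart (by unfold Apart; omega)) rfl

theorem Tprod_stride_spread {c t N l j r : ℕ} (ht : t + 1 < N) (hl : l = c + 2 * t)
    (hb : l + 1 = j ∧ j + 1 = r) (hj : 1 ≤ j ∧ j ≤ n) :
    Tprod n (stride c N) (E n j) = spread n l j r := by
  obtain ⟨M, rfl⟩ : ∃ M, N = t + (2 + M) := ⟨N - t - 2, by omega⟩
  rw [stride_add, stride_add, Tprod_append, Tprod_append, Tprod_fixed (y := E n j)]
  · change Tprod n _ (T n (c + 2 * t) (T n (c + 2 * t + 2) (E n j))) = _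
    rw [← hl, show l + 2 = r by omega]
    refine Tprod_fixed (y := spread n l j r) fun i hi => ?_
    obtain ⟨s, hs, rfl⟩ := mem_stride.1 hi
    exact T_spread (Or.inl hb) hj (by unfold Apart; omega) (by unfold Apart; omega)
      (by unfold Apart; omega)
  · intro i hi
    obtain ⟨s, hs, rfl⟩ := mem_stride.1 hi
    exact T_E_apart (by unfold Apart; omega)

/-- The product of the `T_i` over the odd `i`. -/
noncomputable abbrev Todd (n : ℕ) : U n →ₐ[Qv] U n := Tprod n (odds n)

/-- The product of the `T_i` over the even `i`. -/
noncomputable abbrev Teven (n : ℕ) : U n →ₐ[Qv] U n := Tprod n (evens (n - 1))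

theorem Todd_eq (y : U n) :
    Todd n y = Tprod n (stride 1 ((n + 1) / 2)) y := by
  simp [Todd, odds, stride, add_comm]

/-- The list 2, 4, …, n - 1 is padded with 0 and n + 1, where `T` is the identity. Every odd vertex,
including 1 and n, then has both neighbours in the list. -/
theorem Teven_eq (hn : Odd n) (y : U n) :
    Teven n y = Tprod n (stride 0 ((n + 3) / 2)) y := by
  obtain ⟨m, rfl⟩ := hn
  have e : (2 * m + 1 + 3) / 2 = 1 + (m + 1) := by omega
  have e' : evens (2 * m + 1 - 1) = stride 2 m := by
    simp [evens, stride, add_comm]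
  rw [e, stride_add, stride_add, Tprod_append, Tprod_append]
  change Tprod _ _ y = T _ 0 (Tprod _ _ (T _ (0 + 2 * 1 + 2 * m) y))
  rw [T_of_not_mem (by omega), T_of_not_mem (by omega), ← e']

theorem Todd_E {l j r : ℕ} (hn : Odd n) (hj : Even j) (hb : Between l j r) (h : 2 ≤ j ∧ j ≤ n) :
    Todd n (E n j) = spread n l j r := by
  obtain ⟨m, rfl⟩ := hn
  obtain ⟨t, rfl⟩ := hj
  rw [Todd_eq, Tprod_stride_spread (l := t + t - 1) (r := t + t + 1) (t := t - 1)]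
  · rcases hb with hb | hb
    · congr 1 <;> omega
    · rw [spread_symm (Or.inr hb)]
      congr 1 <;> omega
  all_goals omega

theorem Teven_E {l j r : ℕ} (hn : Odd n) (hj : Odd j) (hb : Between l j r) (h : j ≤ n) :
    Teven n (E n j) = spread n l j r := by
  obtain ⟨m, rfl⟩ := hn
  obtain ⟨t, rfl⟩ := hj
  rw [Teven_eq ⟨m, rfl⟩, Tprod_stride_spread (l := 2 * t) (r := 2 * t + 1 + 1) (t := t)]
  · rcases hb with hb | hb
    · congr 1 <;> omega
    · rw [spread_symm (Or.inr hb)]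
      congr 1 <;> omega
  all_goals omega

theorem Todd_negFK {j : ℕ} (hn : Odd n) (hj : Odd j) (h : j ≤ n) :
    Todd n (negFK n j) = E n j := by
  obtain ⟨m, rfl⟩ := hn
  obtain ⟨t, rfl⟩ := hj
  rw [Todd_eq, Tprod_stride_negFK (t := t)] <;> omega

theorem Teven_negFK {j : ℕ} (hn : Odd n) (hj : Even j) (h : j ≤ n) :
    Teven n (negFK n j) = E n j := by
  obtain ⟨m, rfl⟩ := hn
  obtain ⟨t, rfl⟩ := hj
  rw [Teven_eq ⟨m, rfl⟩, Tprod_stride_negFK (t := t)] <;> omega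

theorem Teven_E_self {j : ℕ} (hn : Odd n) (hj : Even j) (h : j ≤ n) :
    Teven n (E n j) = T n j (E n j) := by
  obtain ⟨m, rfl⟩ := hn
  obtain ⟨t, rfl⟩ := hj
  rw [Teven_eq ⟨m, rfl⟩, Tprod_stride_E (t := t)] <;> omega

theorem odd_of_next {i j : ℕ} (h : Next i j) (hi : Even i) : Odd j := by
  unfold Next at h
  rw [Nat.even_iff] at hi
  rw [Nat.odd_iff]
  omega

/-- `Teven` turns [[E_j, E_l], E_r] into [[T_j(E_j), T_k T_j(E_l)], T_j T_s(E_r)]. Since T_k fixes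
T_j(E_j), the inner commutator is T_k of [T_j(E_j), T_j(E_l)] = E_l. -/
theorem Teven_spread {k l j r s : ℕ} (hn : Odd n) (hj : Even j) (h1 : Between k l j)
    (h2 : Between l j r) (h3 : Between j r s) (hl : 1 ≤ l ∧ l ≤ n) (hr : 1 ≤ r ∧ r ≤ n) :
    Teven n (spread n l j r) = wide n k l j r s := by
  have ol : Odd l := odd_of_next (by unfold Next Between at *; omega) hj
  have or : Odd r := odd_of_next (by unfold Next Between at *; omega) hj
  have bj : 1 ≤ j ∧ j ≤ n := by unfold Between at *; omega
  rw [spread_mid h2 hl hr, map_qcomm, map_qcomm, Teven_E hn or h3 hr.2, Teven_E hn ol h1 hl.2,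
    Teven_E_self hn hj bj.2, wide, spread]
  have e := congrArg (T n k) (qcomm_T_E (n := n) (i := j) (j := l)
    (by unfold Next Between at *; omega) bj hl)
  rw [map_qcomm, T_T_E_self_apart (by unfold Apart Between at *; omega)] at e
  rw [e]

end Strides


/-! ### The root vectors through `Todd` and `Teven` -/

section RootVectors

variable {n : ℕ}

theorem mem_odds {m i : ℕ} (h : i ∈ odds m) : i ≤ m := by
  simp only [odds, List.mem_map, List.mem_range] at h
  omega

theorem mem_evens {m i : ℕ} (h : i ∈ evens m) : 2 ≤ i ∧ i ≤ m := by
  simp only [evens, List.mem_map, List.mem_range] at h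
  omega

theorem Tprod_odds_E {j : ℕ} (hj : Odd j) : Tprod n (odds (j - 2)) (E n j) = E n j := by
  obtain ⟨t, rfl⟩ := hj
  refine Tprod_fixed fun i hi => T_E_apart ?_
  -- For j = 1 the truncated difference j - 2 is 0, and the list is empty.
  by_cases h : t = 0
  · subst h
    simp [odds] at hi
  · have := mem_odds hi
    unfold Apart; omega

theorem Tprod_evens_E (j : ℕ) : Tprod n (evens (j - 2)) (E n j) = E n j := by
  refine Tprod_fixed fun i hi => T_E_apart ?_
  have := mem_evens hi
  unfold Apart; omega

theorem coe_uGen {i : ℕ} (hi : Odd i) (h : i ≤ n) : (uGen n i : U n) = E n i := by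
  rw [uGen_eq hi h, Tprod_odds_E hi]

theorem coe_vGen {i : ℕ} (hn : Odd n) (hi : Even i) (h : 2 ≤ i) (h' : i ≤ n - 1) :
    (vGen n i : U n) = Todd n (E n i) := by
  rw [vGen_eq hn hi h h', Tprod_append, Tprod_evens_E]

theorem coe_wGen {i : ℕ} (hn : Odd n) (hi : Odd i) (h : i ≤ n) :
    (wGen n i : U n) = Todd n (Teven n (E n i)) := by
  rw [wGen_eq hn hi h, Tprod_append, Tprod_odds_E hi]

theorem coe_xGen {i : ℕ} (hn : Odd n) (hi : Even i) (h : 2 ≤ i) (h' : i ≤ n - 1) :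
    (xGen n i : U n) = Todd n (Teven n (Todd n (E n i))) := by
  rw [xGen_eq hn hi h h', Tprod_append, Tprod_append, Tprod_evens_E]

end RootVectors

/-! ### The straightening relations, by pairs of families -/

section Straightening

variable {n k l j r s t : ℕ}

theorem vu_skew (hn : Odd n) (hj : Even j) (hjn : 2 ≤ j ∧ j ≤ n - 1) (h : Between l j r) :
    vGen n j * uGen n r = vv • (uGen n r * vGen n j) := by
  have or : Odd r := odd_of_next (by unfold Next Between at *; omega) hj
  have br : 1 ≤ r ∧ r ≤ n := by unfold Between at *; omega
  apply Subtype.ext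
  push_cast
  rw [coe_vGen hn hj hjn.1 hjn.2, coe_uGen or br.2, Todd_E hn hj h (by omega)]
  exact spread_mul_E h (by omega) br

theorem wv_skew (hn : Odd n) (hj : Odd j) (hr : Even r) (hjn : j ≤ n) (h : Between l j r)
    (hrn : 2 ≤ r ∧ r ≤ n - 1) :
    wGen n j * vGen n r = vv • (vGen n r * wGen n j) := by
  apply Subtype.ext
  push_cast
  rw [coe_wGen hn hj hjn, coe_vGen hn hr hrn.1 hrn.2, Teven_E hn hj h hjn, ← map_mul, ← map_mul,
    spread_mul_E h (by unfold Between at h; omega) (by omega), map_smul]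

theorem xw_skew (hn : Odd n) (hj : Even j) (hjn : 2 ≤ j ∧ j ≤ n - 1) (h : Between l j r) :
    xGen n j * wGen n r = vv • (wGen n r * xGen n j) := by
  have or : Odd r := odd_of_next (by unfold Next Between at *; omega) hj
  have br : 1 ≤ r ∧ r ≤ n := by unfold Between at *; omega
  -- x_j and w_r are the images of v_j and u_r under T = `Todd` ∘ `Teven`.
  have e := congrArg (fun y : UPlus n => Todd n (Teven n y)) (vu_skew hn hj hjn h)
  apply Subtype.ext
  push_cast
  push_cast at e
  rw [coe_vGen hn hj hjn.1 hjn.2, coe_uGen or br.2] at e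
  rw [coe_xGen hn hj hjn.1 hjn.2, coe_wGen hn or br.2]
  simpa only [map_mul, map_smul] using e

/-- Here u_s = Todd(-F_s K_s), so `Todd` is a common outer factor and the relation is one between
T_l T_r(E_j) and -F_s K_s. -/
theorem wu_skew (hn : Odd n) (hj : Odd j) (hs : Odd s) (hjn : j ≤ n) (hsn : s ≤ n)
    (h : Between l j r) (h' : Between j r s) :
    wGen n j * uGen n s = vv • (uGen n s * wGen n j) := by
  apply Subtype.ext
  push_cast
  have := hj.pos
  have := hs.pos
  rw [coe_wGen hn hj hjn, coe_uGen hs hsn, Teven_E hn hj h hjn, ← Todd_negFK hn hs hsn, ← map_mul,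
    ← map_mul, spread_mul_negFK h h' (by omega) (by unfold Between at *; omega), map_smul]

/-- The same argument one level deeper: v_s = Todd Teven(-F_s K_s), and the common factor is T. -/
theorem xv_skew (hn : Odd n) (hj : Even j) (hs : Even s) (hjn : 2 ≤ j ∧ j ≤ n - 1)
    (hsn : 2 ≤ s ∧ s ≤ n - 1) (h : Between l j r) (h' : Between j r s) :
    xGen n j * vGen n s = vv • (vGen n s * xGen n j) := by
  apply Subtype.ext
  push_cast
  rw [coe_xGen hn hj hjn.1 hjn.2, coe_vGen hn hs hsn.1 hsn.2, Todd_E hn hj h (by omega),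
    ← Teven_negFK hn hs (by omega), ← map_mul, ← map_mul, ← map_mul, ← map_mul,
    spread_mul_negFK h h' (by omega) (by unfold Between at *; omega), map_smul, map_smul]

theorem wu_mid (hn : Odd n) (hj : Odd j) (hjn : 3 ≤ j ∧ j ≤ n - 2) :
    wGen n j * uGen n j = uGen n j * wGen n j + (vv - vv⁻¹) • (vGen n (j - 1) * vGen n (j + 1)) := by
  have h : Between (j - 1) j (j + 1) := by unfold Between; omega
  have el : Even (j - 1) := by grind
  have er : Even (j + 1) := by grind
  apply Subtype.ext
  push_cast
  rw [coe_wGen hn hj (by omega), coe_uGen hj (by omega), coe_vGen hn el (by omega) (by omega),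
    coe_vGen hn er (by omega) (by omega), Teven_E hn hj h (by omega),
    ← Todd_negFK hn hj (by omega)]
  have e := congrArg (Todd n) (spread_mul_negFK_mid h (n := n) (by omega) (by omega))
  simpa only [map_mul, map_smul, map_add] using e

theorem wu_end (hn : Odd n) (hj : Odd j) (hjn : j ≤ n) (h : Between l j r)
    (hl : 2 ≤ l ∧ l ≤ n - 1) (hr : ¬ (1 ≤ r ∧ r ≤ n)) :
    wGen n j * uGen n j = vv⁻¹ • (uGen n j * wGen n j) + vGen n l := by
  have el : Even l := by unfold Between at h; grind
  have := hj.pos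
  apply Subtype.ext
  push_cast
  rw [coe_wGen hn hj (by omega), coe_uGen hj (by omega), coe_vGen hn el (by omega) (by omega),
    Teven_E hn hj h (by omega), ← Todd_negFK hn hj (by omega)]
  have e := congrArg (Todd n) (spread_mul_negFK_end h (n := n) (by omega) (by omega) hr)
  simpa only [map_mul, map_smul, map_add] using e

theorem xv_mid (hn : Odd n) (hj : Even j) (hjn : 2 ≤ j ∧ j ≤ n - 1) :
    xGen n j * vGen n j = vGen n j * xGen n j + (vv - vv⁻¹) • (wGen n (j - 1) * wGen n (j + 1)) := by
  have h : Between (j - 1) j (j + 1) := by unfold Between; omega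
  have ol : Odd (j - 1) := by grind
  have or : Odd (j + 1) := by grind
  apply Subtype.ext
  push_cast
  rw [coe_xGen hn hj (by omega) (by omega), coe_vGen hn hj (by omega) (by omega),
    coe_wGen hn ol (by omega), coe_wGen hn or (by omega)]
  have e := congrArg (fun y => Todd n (Teven n y))
    (spread_mul_negFK_mid h (n := n) (by omega) (by omega))
  simpa only [← Todd_E hn hj h (by omega : 2 ≤ j ∧ j ≤ n), map_mul, map_smul, map_add,
    Teven_negFK hn hj (by omega : j ≤ n)] using e

/-- Both orientations of the chain k, l, j, r, s are allowed and give the same x_j. In each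
noncommuting pair with a vector u, the orientation is chosen so that the index of u lies on the side
of `r`. -/
theorem coe_xGen_eq_wide (hn : Odd n) (hj : Even j) (hjn : 2 ≤ j ∧ j ≤ n - 1)
    (h1 : Between k l j) (h2 : Between l j r) (h3 : Between j r s) :
    (xGen n j : U n) = Todd n (wide n k l j r s) := by
  rw [coe_xGen hn hj hjn.1 hjn.2, Todd_E hn hj h2 (by omega), Teven_spread hn hj h1 h2 h3] <;>
    (unfold Between at *; omega)

theorem xu_skew (hn : Odd n) (hj : Even j) (ht : Odd t) (hjn : 2 ≤ j ∧ j ≤ n - 1) (htn : t ≤ n)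
    (h1 : Between k l j) (h2 : Between l j r) (h3 : Between j r s) (h4 : Between r s t) :
    xGen n j * uGen n t = vv • (uGen n t * xGen n j) := by
  have := ht.pos
  apply Subtype.ext
  push_cast
  rw [coe_xGen_eq_wide hn hj hjn h1 h2 h3, coe_uGen ht htn, ← Todd_negFK hn ht htn, ← map_mul,
    ← map_mul, wide_mul_negFK_skew h1 h2 h3 (by unfold Between at *; omega) h4
      (by unfold Between at *; omega), map_smul]

theorem wv_comm (hn : Odd n) (hj : Odd j) (ht : Even t) (hjn : j ≤ n) (htn : 2 ≤ t ∧ t ≤ n - 1)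
    (h : j + 3 ≤ t ∨ t + 3 ≤ j) : wGen n j * vGen n t = vGen n t * wGen n j := by
  have := hj.pos
  apply Subtype.ext
  push_cast
  have hb : Between (j - 1) j (j + 1) := by unfold Between; omega
  rw [coe_wGen hn hj hjn, coe_vGen hn ht htn.1 htn.2, Teven_E hn hj hb hjn, ← map_mul, ← map_mul,
    spread_comm (T_E_apart _) (T_E_apart _) (E_comm_apart _)] <;> (unfold Apart; omega)

theorem xu_mid (hn : Odd n) (hj : Even j) (hjn : 2 ≤ j ∧ j ≤ n - 1)
    (h1 : Between k l j) (h2 : Between l j r) (h3 : Between j r s) (hs : 2 ≤ s ∧ s ≤ n - 1) :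
    xGen n j * uGen n r = uGen n r * xGen n j + (vv - vv⁻¹) • (vGen n s * wGen n l) := by
  have or : Odd r := odd_of_next (by unfold Next Between at *; omega) hj
  have ol : Odd l := odd_of_next (by unfold Next Between at *; omega) hj
  have es : Even s := by unfold Between at *; grind
  have br : 1 ≤ r ∧ r ≤ n := by unfold Between at *; omega
  have bl : 1 ≤ l ∧ l ≤ n := by unfold Between at *; omega
  -- The computation yields w_l v_s, in this order; l and s are three apart, so the two commute.
  rw [← wv_comm hn ol es bl.2 hs (by unfold Between at *; omega)]
  apply Subtype.ext
  push_cast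
  rw [coe_xGen_eq_wide hn hj hjn h1 h2 h3, coe_uGen or br.2, coe_wGen hn ol bl.2,
    coe_vGen hn es hs.1 hs.2, ← Todd_negFK hn or br.2, Teven_E hn ol h1 bl.2]
  have e := congrArg (Todd n)
    (wide_mul_negFK_mid h1 h2 h3 bl (n := n) (by omega) (by omega))
  simpa only [map_mul, map_smul, map_add] using e

theorem xu_end (hn : Odd n) (hj : Even j) (hjn : 2 ≤ j ∧ j ≤ n - 1)
    (h1 : Between k l j) (h2 : Between l j r) (h3 : Between j r s) (hs : ¬ (1 ≤ s ∧ s ≤ n)) :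
    xGen n j * uGen n r = vv⁻¹ • (uGen n r * xGen n j) + wGen n l := by
  have or : Odd r := odd_of_next (by unfold Next Between at *; omega) hj
  have ol : Odd l := odd_of_next (by unfold Next Between at *; omega) hj
  have br : 1 ≤ r ∧ r ≤ n := by unfold Between at *; omega
  have bl : 1 ≤ l ∧ l ≤ n := by unfold Between at *; omega
  apply Subtype.ext
  push_cast
  rw [coe_xGen_eq_wide hn hj hjn h1 h2 h3, coe_uGen or br.2, coe_wGen hn ol bl.2,
    ← Todd_negFK hn or br.2, Teven_E hn ol h1 bl.2]
  have e := congrArg (Todd n)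
    (wide_mul_negFK_end h1 h2 h3 bl (n := n) (by omega) br hs)
  simpa only [map_mul, map_smul, map_add] using e

theorem uu_comm (hj : Odd j) (ht : Odd t) (hjn : j ≤ n) (htn : t ≤ n) (h : Apart j t) :
    uGen n j * uGen n t = uGen n t * uGen n j := by
  apply Subtype.ext
  push_cast
  rw [coe_uGen hj hjn, coe_uGen ht htn, E_comm_apart h]

theorem vv_comm (hn : Odd n) (hj : Even j) (ht : Even t) (hjn : 2 ≤ j ∧ j ≤ n - 1)
    (htn : 2 ≤ t ∧ t ≤ n - 1) (h : Apart j t) : vGen n j * vGen n t = vGen n t * vGen n j := by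
  apply Subtype.ext
  push_cast
  rw [coe_vGen hn hj hjn.1 hjn.2, coe_vGen hn ht htn.1 htn.2, ← map_mul, E_comm_apart h, map_mul]

theorem ww_comm (hn : Odd n) (hj : Odd j) (ht : Odd t) (hjn : j ≤ n) (htn : t ≤ n)
    (h : Apart j t) : wGen n j * wGen n t = wGen n t * wGen n j := by
  apply Subtype.ext
  push_cast
  rw [coe_wGen hn hj hjn, coe_wGen hn ht htn, ← map_mul, ← map_mul, E_comm_apart h, map_mul,
    map_mul]

theorem xx_comm (hn : Odd n) (hj : Even j) (ht : Even t) (hjn : 2 ≤ j ∧ j ≤ n - 1)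
    (htn : 2 ≤ t ∧ t ≤ n - 1) (h : Apart j t) : xGen n j * xGen n t = xGen n t * xGen n j := by
  apply Subtype.ext
  push_cast
  rw [coe_xGen hn hj hjn.1 hjn.2, coe_xGen hn ht htn.1 htn.2, ← map_mul, ← map_mul, ← map_mul,
    E_comm_apart h, map_mul, map_mul, map_mul]

theorem vu_comm (hn : Odd n) (hj : Even j) (ht : Odd t) (hjn : 2 ≤ j ∧ j ≤ n - 1) (htn : t ≤ n)
    (h : j + 3 ≤ t ∨ t + 3 ≤ j) : vGen n j * uGen n t = uGen n t * vGen n j := by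
  have hb : Between (j - 1) j (j + 1) := by unfold Between; omega
  apply Subtype.ext
  push_cast
  rw [coe_vGen hn hj hjn.1 hjn.2, coe_uGen ht htn, Todd_E hn hj hb (by omega),
    spread_comm (T_E_apart _) (T_E_apart _) (E_comm_apart _)] <;> (unfold Apart; omega)

theorem xw_comm (hn : Odd n) (hj : Even j) (ht : Odd t) (hjn : 2 ≤ j ∧ j ≤ n - 1) (htn : t ≤ n)
    (h : j + 3 ≤ t ∨ t + 3 ≤ j) : xGen n j * wGen n t = wGen n t * xGen n j := by
  have e := congrArg (fun y : UPlus n => Todd n (Teven n y)) (vu_comm hn hj ht hjn htn h)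
  apply Subtype.ext
  push_cast
  push_cast at e
  rw [coe_vGen hn hj hjn.1 hjn.2, coe_uGen ht htn] at e
  rw [coe_xGen hn hj hjn.1 hjn.2, coe_wGen hn ht htn]
  simpa only [map_mul] using e

theorem wu_comm (hn : Odd n) (hj : Odd j) (ht : Odd t) (hjn : j ≤ n) (htn : t ≤ n)
    (h : j + 4 ≤ t ∨ t + 4 ≤ j) : wGen n j * uGen n t = uGen n t * wGen n j := by
  have := hj.pos
  have hb : Between (j - 1) j (j + 1) := by unfold Between; omega
  apply Subtype.ext
  push_cast
  rw [coe_wGen hn hj hjn, coe_uGen ht htn, Teven_E hn hj hb hjn, ← Todd_negFK hn ht htn,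
    ← map_mul, ← map_mul,
    spread_comm (T_negFK_apart _) (T_negFK_apart _) (E_negFK_apart _)] <;> (unfold Apart; omega)

theorem xv_comm (hn : Odd n) (hj : Even j) (ht : Even t) (hjn : 2 ≤ j ∧ j ≤ n - 1)
    (htn : 2 ≤ t ∧ t ≤ n - 1) (h : j + 4 ≤ t ∨ t + 4 ≤ j) :
    xGen n j * vGen n t = vGen n t * xGen n j := by
  have hb : Between (j - 1) j (j + 1) := by unfold Between; omega
  apply Subtype.ext
  push_cast
  rw [coe_xGen hn hj hjn.1 hjn.2, coe_vGen hn ht htn.1 htn.2, Todd_E hn hj hb (by omega),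
    ← Teven_negFK hn ht (by omega), ← map_mul, ← map_mul, ← map_mul, ← map_mul,
    spread_comm (T_negFK_apart _) (T_negFK_apart _) (E_negFK_apart _)] <;> (unfold Apart; omega)

theorem xu_comm (hn : Odd n) (hj : Even j) (ht : Odd t) (hjn : 2 ≤ j ∧ j ≤ n - 1) (htn : t ≤ n)
    (h : j + 5 ≤ t ∨ t + 5 ≤ j) : xGen n j * uGen n t = uGen n t * xGen n j := by
  apply Subtype.ext
  push_cast
  rw [coe_xGen_eq_wide hn hj hjn (k := j - 2) (l := j - 1) (r := j + 1) (s := j + 2)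
    (by unfold Between; omega) (by unfold Between; omega) (by unfold Between; omega),
    coe_uGen ht htn, ← Todd_negFK hn ht htn, ← map_mul, ← map_mul, wide_mul_negFK_comm] <;>
    (unfold Apart; omega)

theorem position_cases (hn : Odd n) {p : ℕ} (h : 1 ≤ p ∧ p ≤ 2 * n) :
    (∃ i, Odd i ∧ i ≤ n ∧ p = posU i) ∨ (∃ i, Even i ∧ (2 ≤ i ∧ i ≤ n - 1) ∧ p = posV n i) ∨
    (∃ i, Odd i ∧ i ≤ n ∧ p = posW n i) ∨ (∃ i, Even i ∧ (2 ≤ i ∧ i ≤ n - 1) ∧ p = posX n i) := by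
  obtain ⟨m, rfl⟩ := hn
  unfold posU posV posW posX
  -- For n = 2m + 1 the blocks u, v, w, x have lengths m + 1, m, m + 1, m.
  rcases le_or_gt p (m + 1) with h1 | h1
  · exact .inl ⟨2 * (p - 1) + 1, ⟨_, rfl⟩, by omega⟩
  rcases le_or_gt p (2 * m + 1) with h2 | h2
  · exact .inr (.inl ⟨2 * (p - (m + 1)), even_two_mul _, by omega⟩)
  rcases le_or_gt p (3 * m + 2) with h3 | h3
  · exact .inr (.inr (.inl ⟨2 * (p - (2 * m + 1) - 1) + 1, ⟨_, rfl⟩, by omega⟩))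
  · exact .inr (.inr (.inr ⟨2 * (p - (3 * m + 2)), even_two_mul _, by omega⟩))

/-- Within one family distinct indices of equal parity are automatically apart. For two families,
the indices too close for the commutation lemma are finitely many offsets, and each of them is
listed. -/
theorem comm_of_not_listed (hodd : Odd n) (hn : 3 ≤ n) {p q : ℕ} (hp : 1 ≤ p) (hpq : p < q)
    (hq : q ≤ 2 * n) (hl : ¬ Listed n q p) : Eβ n q * Eβ n p = Eβ n p * Eβ n q := by
  have hm := Nat.odd_iff.1 hodd
  rcases position_cases hodd ⟨hp, by omega⟩ with ⟨i, hi, hin, rfl⟩ | ⟨i, hi, hin, rfl⟩ |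
    ⟨i, hi, hin, rfl⟩ | ⟨i, hi, hin, rfl⟩ <;>
  rcases position_cases hodd (p := q) ⟨by omega, hq⟩ with ⟨j, hj, hjn, rfl⟩ | ⟨j, hj, hjn, rfl⟩ |
    ⟨j, hj, hjn, rfl⟩ | ⟨j, hj, hjn, rfl⟩ <;>
  have hi' := hi <;> have hj' := hj <;>
  simp only [Nat.odd_iff, Nat.even_iff] at hi' hj' <;>
  -- The six pairs of blocks in the wrong order contradict p < q; ten remain.
  try (exfalso; simp only [posU, posV, posW, posX] at hpq; omega)
  · exact uu_comm hj hi hjn hin (by unfold posU at hpq; unfold Apart; omega)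
  · refine vu_comm hodd hj hi hjn hin ?_
    by_contra hc
    rcases (by omega : j = i + 1 ∨ j = i - 1) with rfl | rfl
    · exact hl (.vu_succ i hi (by omega))
    · exact hl (.vu_pred i hi (by omega))
  · refine wu_comm hodd hj hi hjn hin ?_
    by_contra hc
    rcases (by omega : j = i + 2 ∨ j = i - 2 ∧ 3 ≤ i ∨ j = i) with rfl | ⟨rfl, h3⟩ | rfl
    · exact hl (.wu_succ i hi (by omega))
    · exact hl (.wu_pred i hi (by omega))
    · rcases (by omega : j = 1 ∨ j = n ∨ 3 ≤ j ∧ j ≤ n - 2) with rfl | rfl | h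
      · exact hl .wu_first
      · exact hl .wu_last
      · exact hl (.wu_mid j hi h)
  · refine xu_comm hodd hj hi hjn hin ?_
    by_contra hc
    rcases (by omega : j = i + 3 ∨ j = i - 3 ∨ j = i + 1 ∨ j = i - 1) with rfl | rfl | rfl | rfl
    · exact hl (.xu_succ_three i hi (by omega))
    · exact hl (.xu_pred_three i hi (by omega))
    · rcases (by omega : i = 1 ∨ 3 ≤ i ∧ i ≤ n - 2) with rfl | h
      · exact hl .xu_first
      · exact hl (.xu_succ i hi h)
    · rcases (by omega : i = n ∨ 3 ≤ i ∧ i ≤ n - 2) with rfl | h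
      · exact hl .xu_last
      · exact hl (.xu_pred i hi h)
  · exact vv_comm hodd hj hi hjn hin (by unfold posV at hpq; unfold Apart; omega)
  · refine wv_comm hodd hj hi hjn hin ?_
    by_contra hc
    rcases (by omega : j = i + 1 ∨ j = i - 1) with rfl | rfl
    · exact hl (.wv_succ i hi hin)
    · exact hl (.wv_pred i hi hin)
  · refine xv_comm hodd hj hi hjn hin ?_
    by_contra hc
    rcases (by omega : j = i + 2 ∨ j = i - 2 ∨ j = i) with rfl | rfl | rfl
    · exact hl (.xv_succ i hi (by omega))
    · exact hl (.xv_pred i hi (by omega))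
    · exact hl (.xv_same _ hi hin)
  · exact ww_comm hodd hj hi hjn hin (by unfold posW at hpq; unfold Apart; omega)
  · refine xw_comm hodd hj hi hjn hin ?_
    by_contra hc
    rcases (by omega : j = i + 1 ∨ j = i - 1) with rfl | rfl
    · exact hl (.xw_succ i hi (by omega))
    · exact hl (.xw_pred i hi (by omega))
  · exact xx_comm hodd hj hi hjn hin (by unfold posX at hpq; unfold Apart; omega)

end Straightening

end QuantumGroup

/-! ### Assembly of the relations -/

theorem mainTheorem3 (n : ℕ) (hodd : Odd n) (hn : 3 ≤ n) :
    -- pairs `v`, `u`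
    (∀ i, Odd i → 1 ≤ i → i ≤ n - 2 →
      vGen n (i + 1) * uGen n i = vv • (uGen n i * vGen n (i + 1))) ∧
    (∀ i, Odd i → 3 ≤ i → i ≤ n →
      vGen n (i - 1) * uGen n i = vv • (uGen n i * vGen n (i - 1))) ∧
    -- pairs `w`, `u`
    (∀ i, Odd i → 1 ≤ i → i ≤ n - 2 →
      wGen n (i + 2) * uGen n i = vv • (uGen n i * wGen n (i + 2))) ∧
    (∀ i, Odd i → 3 ≤ i → i ≤ n →
      wGen n (i - 2) * uGen n i = vv • (uGen n i * wGen n (i - 2))) ∧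
    (wGen n 1 * uGen n 1 = vv⁻¹ • (uGen n 1 * wGen n 1) + vGen n 2) ∧
    (∀ i, Odd i → 3 ≤ i → i ≤ n - 2 →
      wGen n i * uGen n i =
        uGen n i * wGen n i + (vv - vv⁻¹) • (vGen n (i - 1) * vGen n (i + 1))) ∧
    (wGen n n * uGen n n = vv⁻¹ • (uGen n n * wGen n n) + vGen n (n - 1)) ∧
    -- pairs `x`, `u`
    (∀ i, Odd i → 1 ≤ i → i ≤ n - 4 →
      xGen n (i + 3) * uGen n i = vv • (uGen n i * xGen n (i + 3))) ∧
    (∀ i, Odd i → 5 ≤ i → i ≤ n →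
      xGen n (i - 3) * uGen n i = vv • (uGen n i * xGen n (i - 3))) ∧
    (∀ i, Odd i → 3 ≤ i → i ≤ n - 2 →
      xGen n (i - 1) * uGen n i =
        uGen n i * xGen n (i - 1) + (vv - vv⁻¹) • (vGen n (i + 1) * wGen n (i - 2))) ∧
    (xGen n (n - 1) * uGen n n = vv⁻¹ • (uGen n n * xGen n (n - 1)) + wGen n (n - 2)) ∧
    (xGen n 2 * uGen n 1 = vv⁻¹ • (uGen n 1 * xGen n 2) + wGen n 3) ∧
    (∀ i, Odd i → 3 ≤ i → i ≤ n - 2 →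
      xGen n (i + 1) * uGen n i =
        uGen n i * xGen n (i + 1) + (vv - vv⁻¹) • (vGen n (i - 1) * wGen n (i + 2))) ∧
    -- pairs `w`, `v`
    (∀ i, Even i → 2 ≤ i → i ≤ n - 1 →
      wGen n (i + 1) * vGen n i = vv • (vGen n i * wGen n (i + 1))) ∧
    (∀ i, Even i → 2 ≤ i → i ≤ n - 1 →
      wGen n (i - 1) * vGen n i = vv • (vGen n i * wGen n (i - 1))) ∧
    -- pairs `x`, `v`
    (∀ i, Even i → 2 ≤ i → i ≤ n - 3 →
      xGen n (i + 2) * vGen n i = vv • (vGen n i * xGen n (i + 2))) ∧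
    (∀ i, Even i → 4 ≤ i → i ≤ n - 1 →
      xGen n (i - 2) * vGen n i = vv • (vGen n i * xGen n (i - 2))) ∧
    (∀ i, Even i → 2 ≤ i → i ≤ n - 1 →
      xGen n i * vGen n i =
        vGen n i * xGen n i + (vv - vv⁻¹) • (wGen n (i - 1) * wGen n (i + 1))) ∧
    -- pairs `x`, `w`
    (∀ i, Odd i → 1 ≤ i → i ≤ n - 2 →
      xGen n (i + 1) * wGen n i = vv • (wGen n i * xGen n (i + 1))) ∧
    (∀ i, Odd i → 3 ≤ i → i ≤ n →
      xGen n (i - 1) * wGen n i = vv • (wGen n i * xGen n (i - 1))) ∧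
    -- all other pairs commute
    (∀ i j, 1 ≤ i → i < j → j ≤ 2 * n → ¬ Listed n j i →
      Eβ n j * Eβ n i = Eβ n i * Eβ n j) := by
  -- Decreasing chains serve the relations whose left factor has the larger index; the mirror
  -- relations receive increasing chains.
  have bt (a : ℕ) : Between (a + 2) (a + 1) a := .inr ⟨rfl, rfl⟩
  have hm := Nat.odd_iff.1 hodd
  have oe {i : ℕ} (c : ℕ) (hi : Odd i) (hc : c % 2 = 1) : Even (i + c) ∧ (c ≤ i → Even (i - c)) := by
    simp only [Nat.odd_iff, Nat.even_iff] at *; omega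
  have oo {i : ℕ} (c : ℕ) (hi : Odd i) (hc : c % 2 = 0) : Odd (i + c) ∧ (c ≤ i → Odd (i - c)) := by
    simp only [Nat.odd_iff] at *; omega
  have eo {i : ℕ} (c : ℕ) (hi : Even i) (hc : c % 2 = 1) : Odd (i + c) ∧ (c ≤ i → Odd (i - c)) := by
    simp only [Nat.odd_iff, Nat.even_iff] at *; omega
  have ee {i : ℕ} (c : ℕ) (hi : Even i) (hc : c % 2 = 0) :
      Even (i + c) ∧ (c ≤ i → Even (i - c)) := by
    simp only [Nat.even_iff] at *; omega
  have hn1 : Even (n - 1) := (oe 1 hodd rfl).2 (by omega)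
  refine ⟨?_, ?_, ?_, ?_, ?_, ?_, ?_, ?_, ?_, ?_, ?_, ?_, ?_, ?_, ?_, ?_, ?_, ?_, ?_, ?_, ?_⟩
  · intro i hi h1 h2
    exact vu_skew hodd (oe 1 hi rfl).1 (by omega) (bt i)
  · intro i hi h1 h2
    exact vu_skew hodd ((oe 1 hi rfl).2 (by omega)) (by omega) (l := i - 2)
      (by unfold Between; omega)
  · intro i hi h1 h2
    exact wu_skew hodd (oo 2 hi rfl).1 hi (by omega) (by omega) (bt (i + 1)) (bt i)
  · intro i hi h1 h2
    exact wu_skew hodd ((oo 2 hi rfl).2 (by omega)) hi (by omega) (by omega) (l := i - 3)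
      (r := i - 1) (by unfold Between; omega) (by unfold Between; omega)
  -- The chain 2, 1, 0 leaves the diagram at 0, which is the missing neighbour of vertex 1.
  · exact wu_end hodd odd_one (by omega) (bt 0) (by omega) (by omega)
  · intro i hi h1 h2
    exact wu_mid hodd hi ⟨h1, h2⟩
  · exact wu_end hodd hodd le_rfl (r := n + 1) (by unfold Between; omega) (by omega) (by omega)
  · intro i hi h1 h2
    exact xu_skew hodd (oe 3 hi rfl).1 hi (by omega) (by omega) (bt (i + 3)) (bt (i + 2))
      (bt (i + 1)) (bt i)
  · intro i hi h1 h2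
    -- For i = 5 the chain starts at k = 0, where `T` is the identity; no bound on `k` is required.
    exact xu_skew hodd ((oe 3 hi rfl).2 (by omega)) hi (by omega) (by omega) (k := i - 5)
      (l := i - 4) (r := i - 2) (s := i - 1) (by unfold Between; omega) (by unfold Between; omega)
      (by unfold Between; omega) (by unfold Between; omega)
  · intro i hi h1 h2
    exact xu_mid hodd ((oe 1 hi rfl).2 (by omega)) (by omega) (k := i - 3)
      (by unfold Between; omega) (by unfold Between; omega) (by unfold Between; omega) (by omega)
  · exact xu_end hodd hn1 (by omega) (k := n - 3) (s := n + 1)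
      (by unfold Between; omega) (by unfold Between; omega) (by unfold Between; omega) (by omega)
  · exact xu_end hodd even_two (by omega) (bt 2) (bt 1) (bt 0) (by omega)
  · intro i hi h1 h2
    exact xu_mid hodd (oe 1 hi rfl).1 (by omega) (bt (i + 1)) (bt i)
      (by unfold Between; omega) (by omega)
  · intro i hi h1 h2
    exact wv_skew hodd (eo 1 hi rfl).1 hi (by omega) (bt i) (by omega)
  · intro i hi h1 h2
    exact wv_skew hodd ((eo 1 hi rfl).2 (by omega)) hi (by omega) (l := i - 2)
      (by unfold Between; omega) (by omega)
  · intro i hi h1 h2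
    exact xv_skew hodd (ee 2 hi rfl).1 hi (by omega) (by omega) (bt (i + 1)) (bt i)
  · intro i hi h1 h2
    exact xv_skew hodd ((ee 2 hi rfl).2 (by omega)) hi (by omega) (by omega) (l := i - 3)
      (r := i - 1) (by unfold Between; omega) (by unfold Between; omega)
  · intro i hi h1 h2
    exact xv_mid hodd hi ⟨h1, h2⟩
  · intro i hi h1 h2
    exact xw_skew hodd (oe 1 hi rfl).1 (by omega) (bt i)
  · intro i hi h1 h2
    exact xw_skew hodd ((oe 1 hi rfl).2 (by omega)) (by omega) (l := i - 2)
      (by unfold Between; omega)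
  · exact fun i j => comm_of_not_listed hodd hn
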